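/- **Model.** For every $T\in\mathbb N$ let $X_t=f_t+\epsilon_t$, $t=1,\dots,T$, where $f=f^{(T)}$ is a deterministic signal, which may depend on $T$, and $\epsilon_1,\dots,\epsilon_T$ are independent $N(0,1)$ variables. Let $\eta_1<\dots<\eta_N$ be the change points of $f$, i.e. the $t\in\{1,\dots,T-1\}$ with $f_t\ne f_{t+1}$, and put $\eta_0=0$, $\eta_{N+1}=T$, $\delta_i=|f_{\eta_i+1}-f_{\eta_i}|$ and $\lambda=\min_{0\le i\le N}(\eta_{i+1}-\eta_i)$. **Seeded intervals.** Let $a\in[1/2,1)$ and let $m\ge 2$ be an integer. For $1\le k\le\lceil\log_{1/a}T\rceil$ put $n_k=2\lceil a^{-(k-1)}\rceil-1$, $l_k=Ta^{k-1}$, $s_k=(T-l_k)/(n_k-1)$ (for $k=1$, where $n_1=1$, put $s_1=0$). Let $\mathcal I$ be the collection of those intervals $(\lfloor (i-1)s_k\rfloor,\lceil (i-1)s_k+l_k\rceil]$, $1\le i\le n_k$, $1\le k\le\lceil\log_{1/a}T\rceil$, that contain at least $m$ integers. **Selection.** For integers $\ell<s<r$ let $$T_{(\ell,r]}(s)=\sqrt{\tfrac{r-s}{(r-\ell)(s-\ell)}}\sum_{t=\ell+1}^sX_t-\sqrt{\tfrac{s-\ell}{(r-\ell)(r-s)}}\sum_{t=s+1}^rX_t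 ,$$ let $\hat s_{(\ell,r]}$ be a maximiser of $|T_{(\ell,r]}(s)|$ over $\ell<s<r$, and call the maximum the gain of $(\ell,r]$. Narrowest-over-threshold selection with threshold $\kappa\ge0$ repeats the following until no interval with gain $>\kappa$ is left in $\mathcal I$: take a shortest interval $(\ell,r]$ among the remaining ones with gain $>\kappa$, add $\hat s_{(\ell,r]}$ to the set of estimates, and remove all intervals containing $\hat s_{(\ell,r]}$. Ties are broken arbitrarily. Let $S(\kappa)$ be the resulting set. For $S\subseteq\{1,\dots,T-1\}$ let $\mathrm{RSS}(S)$ be the residual sum of squares of the fit to $X_1,\dots,X_T$ by segment means with change points $S$, and for $\theta>1$ let $$\mathrm{sSIC}_\theta(S)=\mathrm{RSS}(S)+\gamma\,|S|\,(\log T)^{\theta}$$ be the strengthened Schwarz information criterion, where $\gamma>0$ is a fixed constant ($\gamma=2$ if a location and a level are counted for each change point). The final estimates $\hat\eta_1<\dots<\hat\eta_{\hat N}$ are the elements of $S(\hat\kappa)$, where $\hat\kappa$ minimises $\mathrm{sSIC}_\theta(S(\kappa))$ over $\kappa\ge0$. **Theorem.** Let $1<\theta<\theta_0$, $\gamma>0$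 and $0<c_1<c_2<\infty$. There is a constant $C$, independent of $T$, of $a$, of $m$ and of the signals, such that the following holds for all $a\in[1/2,1)$, all $m\ge2$ and all sequences of signals $f=f^{(T)}$ that satisfy, for all sufficiently large $T$, $\lambda\ge(\log T)^{\theta_0}$, $N\in(c_1,c_2)$ and $\delta_j\in(c_1,c_2)$ for $j=1,\dots,N$: as $T\to\infty$, $$\Pr\Big\{\hat N=N,\ \max_{i=1,\dots,N}\delta_i^2|\hat\eta_i-\eta_i|\le C\log T\Big\}\to1 .$$ -/

import Mathlib

open MeasureTheory ProbabilityTheory Filter Topology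

namespace SeedBS

noncomputable section

/-- The change points of the signal `f 1, …, f T`: the indices `t ∈ {1, …, T - 1}` with
`f t ≠ f (t + 1)`. -/
def changePoints (T : ℕ) (f : ℕ → ℝ) : Finset ℕ :=
  (Finset.Ico 1 T).filter fun t => f t ≠ f (t + 1)

/-- The size `|f (t + 1) - f t|` of the jump of `f` at `t`. -/
def jump (f : ℕ → ℝ) (t : ℕ) : ℝ := |f (t + 1) - f t|

/-- The pairs `(u, v)` of consecutive elements of `{0} ∪ S ∪ {T}`, for `S ⊆ {1, …, T - 1}`; such a
pair stands for the segment `(u, v]`. -/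
def segments (T : ℕ) (S : Finset ℕ) : Finset (ℕ × ℕ) :=
  (insert 0 (insert T S) ×ˢ insert 0 (insert T S)).filter fun p =>
    p.1 < p.2 ∧ ∀ s ∈ S, ¬(p.1 < s ∧ s < p.2)

/-- The minimal distance between consecutive elements of `{0} ∪ S ∪ {T}`. -/
def minSpacing (T : ℕ) (S : Finset ℕ) : ℕ :=
  sInf {d | ∃ p ∈ segments T S, d = p.2 - p.1}

/-- The observations `X 1, …, X T` have means `f 1, …, f T` and independent standard Gaussian
errors. -/
structure IsGaussianModel {Ω : Type*} [MeasurableSpace Ω] (P : Measure Ω) (T : ℕ) (f : ℕ → ℝ)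
    (X : ℕ → Ω → ℝ) : Prop where
  law : ∀ t ∈ Finset.Icc 1 T, HasLaw (fun ω => X t ω - f t) (gaussianReal 0 1) P
  indep : iIndepFun (fun (t : Finset.Icc 1 T) ω => X t ω - f t) P

/-! ### Seeded intervals. A pair `(ℓ, r)` stands for the integer interval `(ℓ, r]`. -/

/-- The number of intervals in the `k`-th layer. -/
def layerCount (a : ℝ) (k : ℕ) : ℕ := 2 * ⌈(1 / a) ^ (k - 1)⌉₊ - 1

/-- The initial length of the intervals in the `k`-th layer. -/
def layerLength (a : ℝ) (T k : ℕ) : ℝ := T * a ^ (k - 1)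

/-- The shift between the intervals in the `k`-th layer; for `k = 1`, where there is a single
interval, the value is `0 / 0 = 0` and plays no role. -/
def layerShift (a : ℝ) (T k : ℕ) : ℝ := (T - layerLength a T k) / ((layerCount a k : ℝ) - 1)

/-- The `k`-th layer of seeded intervals. -/
def layer (a : ℝ) (T k : ℕ) : Finset (ℕ × ℕ) :=
  (Finset.Icc 1 (layerCount a k)).image fun i : ℕ =>
    (⌊((i : ℝ) - 1) * layerShift a T k⌋₊,
      ⌈((i : ℝ) - 1) * layerShift a T k + layerLength a T k⌉₊)

/-- The seeded intervals with decay `a` that contain at least `m` observations. -/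
def seededIntervals (a : ℝ) (m T : ℕ) : Finset (ℕ × ℕ) :=
  ((Finset.Icc 1 ⌈Real.logb (1 / a) T⌉₊).biUnion fun k => layer a T k).filter fun I =>
    m ≤ I.2 - I.1

/-! ### CUSUM statistics and narrowest-over-threshold selection -/

/-- The CUSUM statistic of the data `x` at the split point `s` of the interval `(ℓ, r]`,
`ℓ < s < r`. -/
def cusum (x : ℕ → ℝ) (I : ℕ × ℕ) (s : ℕ) : ℝ :=
  √(((I.2 : ℝ) - s) / (((I.2 : ℝ) - I.1) * ((s : ℝ) - I.1))) * ∑ t ∈ Finset.Ioc I.1 s, x t -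
    √(((s : ℝ) - I.1) / (((I.2 : ℝ) - I.1) * ((I.2 : ℝ) - s))) * ∑ t ∈ Finset.Ioc s I.2, x t

/-- `s` maximises the absolute CUSUM statistic over the split points of the interval `I`. -/
def IsBestSplit (x : ℕ → ℝ) (I : ℕ × ℕ) (s : ℕ) : Prop :=
  s ∈ Finset.Ioo I.1 I.2 ∧ ∀ s' ∈ Finset.Ioo I.1 I.2, |cusum x I s'| ≤ |cusum x I s|

/-- The maximal absolute CUSUM statistic on the interval `I` exceeds `κ`. -/
def OverThreshold (x : ℕ → ℝ) (κ : ℝ) (I : ℕ × ℕ) : Prop :=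
  ∃ s, IsBestSplit x I s ∧ κ < |cusum x I s|

/-- `NOTSelects x κ J S`: narrowest-over-threshold selection with threshold `κ`, started with the
collection `J` of intervals, can return the set `S` of change point estimates. All ways to break
ties (between equally short intervals, or between several best split points) are allowed. -/
inductive NOTSelects (x : ℕ → ℝ) (κ : ℝ) : Finset (ℕ × ℕ) → Finset ℕ → Prop
  | done {J : Finset (ℕ × ℕ)} (none_over : ∀ I ∈ J, ¬OverThreshold x κ I) : NOTSelects x κ J ∅
  | step {J : Finset (ℕ × ℕ)} {S : Finset ℕ} {I : ℕ × ℕ} {s : ℕ} (mem : I ∈ J)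
      (is_over : OverThreshold x κ I)
      (narrowest : ∀ I' ∈ J, OverThreshold x κ I' → I.2 - I.1 ≤ I'.2 - I'.1)
      (best : IsBestSplit x I s)
      (rest : NOTSelects x κ (J.filter fun I' => ¬(I'.1 < s ∧ s ≤ I'.2)) S) :
      NOTSelects x κ J (insert s S)

/-! ### The strengthened Schwarz information criterion -/

/-- The mean of the data over the segment `(p.1, p.2]`. -/
def segmentMean (x : ℕ → ℝ) (p : ℕ × ℕ) : ℝ :=
  (∑ t ∈ Finset.Ioc p.1 p.2, x t) / ((p.2 : ℝ) - p.1)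

/-- The residual sum of squares of the piecewise constant fit with change points `S`. -/
def rss (T : ℕ) (x : ℕ → ℝ) (S : Finset ℕ) : ℝ :=
  ∑ p ∈ segments T S, ∑ t ∈ Finset.Ioc p.1 p.2, (segmentMean x p - x t) ^ 2

/-- The strengthened Schwarz information criterion with exponent `θ`. For errors of variance `1`
the residual sum of squares is, up to an additive constant, `-2` times the maximised
log-likelihood; the weight `γ` is the number of parameters charged per change point (`2` if one
counts a location and a level). -/
def sSIC (γ θ : ℝ) (T : ℕ) (x : ℕ → ℝ) (S : Finset ℕ) : ℝ :=
  rss T x S + γ * (S.card : ℝ) * Real.log T ^ θ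

/-- `S` is an output, for the data `x 1, …, x T`, of seeded binary segmentation with decay `a` and
minimal segment length `m`, narrowest-over-threshold selection, and the threshold chosen among all
`κ ≥ 0` by minimising the strengthened Schwarz information criterion over the solution path
`κ ↦ path κ`. -/
def IsSeedBSEstimate (a : ℝ) (m : ℕ) (γ θ : ℝ) (T : ℕ) (x : ℕ → ℝ) (S : Finset ℕ) : Prop :=
  ∃ path : ℝ → Finset ℕ,
    (∀ κ, 0 ≤ κ → NOTSelects x κ (seededIntervals a m T) (path κ)) ∧
      ∃ κ₀, 0 ≤ κ₀ ∧ path κ₀ = S ∧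
        ∀ κ, 0 ≤ κ → sSIC γ θ T x (path κ₀) ≤ sSIC γ θ T x (path κ)

/-! ### The procedure always has an output -/

theorem exists_notSelects (x : ℕ → ℝ) (κ : ℝ) (J : Finset (ℕ × ℕ)) :
    ∃ S ⊆ J.biUnion (fun I => Finset.Ioo I.1 I.2), NOTSelects x κ J S := by
  classical
  induction J using Finset.strongInduction with
  | H J ih =>
    by_cases h : ∀ I ∈ J, ¬OverThreshold x κ I
    · exact ⟨∅, Finset.empty_subset _, .done h⟩
    · push Not at h
      obtain ⟨I₀, hI₀, ho₀⟩ := h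
      obtain ⟨I, hI, hmin⟩ := (J.filter (OverThreshold x κ)).exists_min_image
        (fun I => I.2 - I.1) ⟨I₀, Finset.mem_filter.2 ⟨hI₀, ho₀⟩⟩
      rw [Finset.mem_filter] at hI
      obtain ⟨s, hs, -⟩ := id hI.2
      have hsI := Finset.mem_Ioo.1 hs.1
      obtain ⟨S, hsub, hS⟩ := ih (J.filter fun I' => ¬(I'.1 < s ∧ s ≤ I'.2))
        ((Finset.filter_ssubset).2 ⟨I, hI.1, by simp only [not_not]; omega⟩)
      refine ⟨insert s S, ?_, .step hI.1 hI.2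
        (fun I' h' o' => hmin I' (Finset.mem_filter.2 ⟨h', o'⟩)) hs hS⟩
      rw [Finset.insert_subset_iff]
      exact ⟨Finset.mem_biUnion.2 ⟨I, hI.1, hs.1⟩,
        hsub.trans (Finset.biUnion_subset_biUnion_of_subset_left _ (Finset.filter_subset _ _))⟩

theorem exists_isSeedBSEstimate (a : ℝ) (m : ℕ) (γ θ : ℝ) (T : ℕ) (x : ℕ → ℝ) :
    ∃ S, IsSeedBSEstimate a m γ θ T x S := by
  choose path hsub hpath using fun κ => exists_notSelects x κ (seededIntervals a m T)
  have hfin : (path '' Set.Ici 0).Finite :=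
    (Finset.finite_toSet (Finset.powerset _)).subset (by
      rintro _ ⟨κ, -, rfl⟩
      exact Finset.mem_coe.2 (Finset.mem_powerset.2 (hsub κ)))
  obtain ⟨_, ⟨κ₀, h₀, rfl⟩, hmin⟩ :=
    Set.exists_min_image _ (sSIC γ θ T x) hfin ⟨path 0, 0, Set.self_mem_Ici, rfl⟩
  exact ⟨path κ₀, path, fun κ _ => hpath κ, κ₀, h₀, rfl, fun κ hκ => hmin _ ⟨κ, hκ, rfl⟩⟩

end

end SeedBS

/-!
With probability tending to one, the squared noise sum over every segment is at most
`w = 8 log T` times its length. The rest of the argument is deterministic. Let `N` be the number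
of change points and `d` their minimal spacing.

* Maximising the CUSUM statistic is the same as minimising the residual sum of squares of a fit
  with one change point. Hence on an interval with CUSUM statistic of order `N √w` the best split
  is close to a change point, since a split far from all of them would leave nearly all of the
  signal unexplained.
* Every change point lies deep inside a seeded interval of length at most `d / 2`. At a threshold
  of order `N √w`, the selection never removes the interval of a change point that is not yet
  found, because it always picks a shortest interval. It therefore finds exactly one estimate near
  every change point.
* The criterion is thus at most its value for a set `S` with the right number of elements.
  Compared with such an `S`, a set that misses a change point loses a multiple of `δ ^ 2 * d`,
  which exceeds all penalties, whereas a set with superfluous elements gains only order `N ^ 2 * w`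
  from the noise, which is less than one penalty. The same comparison bounds the distance of the
  selected estimates from the change points.
-/

namespace SeedBS

/-! ### Signals and their change points -/

section Signal

variable {T : ℕ} {f : ℕ → ℝ}

theorem mem_changePoints {t : ℕ} :
    t ∈ changePoints T f ↔ 1 ≤ t ∧ t < T ∧ f t ≠ f (t + 1) := by
  simp [changePoints, and_assoc]

theorem jump_sq (f : ℕ → ℝ) (t : ℕ) : jump f t ^ 2 = (f (t + 1) - f t) ^ 2 := sq_abs _

/-- `g` is constant between consecutive points of `S` on `{1, …, T}`; a point `s ∈ S` permits a
jump from `s` to `s + 1`. -/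
def IsPiecewiseConst (T : ℕ) (S : Finset ℕ) (g : ℕ → ℝ) : Prop :=
  ∀ t t', 1 ≤ t → t ≤ t' → t' ≤ T → (∀ s ∈ S, s ∉ Finset.Ico t t') → g t = g t'

theorem isPiecewiseConst_changePoints (T : ℕ) (f : ℕ → ℝ) :
    IsPiecewiseConst T (changePoints T f) f := by
  intro t t' ht htt' ht'T h
  induction t', htt' using Nat.le_induction with
  | base => rfl
  | succ n hn ih =>
    rw [ih (by omega) fun η hη hmem => h η hη (Finset.Ico_subset_Ico_right n.le_succ hmem)]
    by_contra hne
    exact h n (mem_changePoints.2 ⟨by omega, by omega, hne⟩) (Finset.mem_Ico.2 ⟨hn, by omega⟩)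

/-- The signal that jumps from `0` to `c` between `η` and `η + 1`; every signal is a constant plus
a sum of such signals. -/
noncomputable def stepAt (η : ℕ) (c : ℝ) (t : ℕ) : ℝ := if η < t then c else 0

theorem signal_eq_add_sum_stepAt {t : ℕ} (ht : t ∈ Finset.Icc 1 T) :
    f t = f 1 + ∑ η ∈ changePoints T f, stepAt η (f (η + 1) - f η) t := by
  obtain ⟨h1, htT⟩ := Finset.mem_Icc.1 ht
  have htelescope : ∑ η ∈ changePoints T f, stepAt η (f (η + 1) - f η) t = f t - f 1 := calc
    _ = ∑ η ∈ Finset.Ico 1 T, stepAt η (f (η + 1) - f η) t :=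
      Finset.sum_filter_of_ne (p := fun η => f η ≠ f (η + 1)) fun η _ hne heq =>
        hne (by simp [stepAt, heq])
    _ = ∑ η ∈ Finset.Ico 1 t, (f (η + 1) - f η) := by
      simp only [stepAt]
      rw [← Finset.sum_filter, Finset.Ico_filter_lt, min_eq_right htT]
    _ = f t - f 1 := Finset.sum_Ico_sub f h1
  rw [htelescope, add_sub_cancel]

/-- The change points of `f` are at distance at least `d` from each other and from `0` and `T`. -/
structure Spaced (T : ℕ) (f : ℕ → ℝ) (d : ℕ) : Prop where
  le_left : ∀ η ∈ changePoints T f, d ≤ η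
  le_right : ∀ η ∈ changePoints T f, η + d ≤ T
  le_sub : ∀ η ∈ changePoints T f, ∀ η' ∈ changePoints T f, η < η' → η + d ≤ η'

theorem mem_segments {S : Finset ℕ} {p : ℕ × ℕ} :
    p ∈ segments T S ↔ (p.1 ∈ insert 0 (insert T S) ∧ p.2 ∈ insert 0 (insert T S)) ∧
      p.1 < p.2 ∧ ∀ s ∈ S, ¬(p.1 < s ∧ s < p.2) := by
  rw [segments, Finset.mem_filter, Finset.mem_product]

theorem minSpacing_le_sub {S : Finset ℕ} {u v : ℕ}
    (hu : u ∈ insert 0 (insert T S)) (hv : v ∈ insert 0 (insert T S)) (huv : u < v) :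
    minSpacing T S ≤ v - u := by
  obtain ⟨w, hw, hmin⟩ := ((insert 0 (insert T S)).filter (u < ·)).exists_min_image id
    ⟨v, Finset.mem_filter.2 ⟨hv, huv⟩⟩
  rw [Finset.mem_filter] at hw
  have hwv : w ≤ v := hmin v (Finset.mem_filter.2 ⟨hv, huv⟩)
  have hseg : (u, w) ∈ segments T S :=
    mem_segments.2 ⟨⟨hu, hw.1⟩, hw.2, fun s hs h =>
      h.2.not_ge (hmin s (Finset.mem_filter.2 ⟨by simp [hs], h.1⟩))⟩
  have hle : minSpacing T S ≤ w - u := Nat.sInf_le ⟨(u, w), hseg, rfl⟩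
  exact hle.trans (Nat.sub_le_sub_right hwv u)

theorem spaced_minSpacing (T : ℕ) (f : ℕ → ℝ) :
    Spaced T f (minSpacing T (changePoints T f)) where
  le_left η hη := by
    have h := mem_changePoints.1 hη
    simpa using minSpacing_le_sub (T := T) (u := 0) (by simp)
      (Finset.mem_insert_of_mem (Finset.mem_insert_of_mem hη)) (by omega)
  le_right η hη := by
    have h := mem_changePoints.1 hη
    have := minSpacing_le_sub (T := T) (v := T)
      (Finset.mem_insert_of_mem (Finset.mem_insert_of_mem hη)) (by simp) (by omega)
    omega
  le_sub η hη η' hη' hlt := by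
    have := minSpacing_le_sub (T := T) (Finset.mem_insert_of_mem (Finset.mem_insert_of_mem hη))
      (Finset.mem_insert_of_mem (Finset.mem_insert_of_mem hη')) hlt
    omega

/-- The distance from `η` to the nearer end of the interval `(I.1, I.2]`. By truncated subtraction
it is `0` when `η` is not strictly between the ends. -/
def depth (I : ℕ × ℕ) (η : ℕ) : ℕ := min (η - I.1) (I.2 - η)

theorem depth_pos {I : ℕ × ℕ} {η : ℕ} : 0 < depth I η ↔ I.1 < η ∧ η < I.2 := by
  simp [depth]

theorem depth_le_abs_sub {I : ℕ × ℕ} {s : ℕ} (hs : ¬(I.1 < s ∧ s ≤ I.2)) (η : ℕ) :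
    (depth I η : ℝ) ≤ |(s : ℝ) - η| := by
  have h : depth I η + η ≤ s ∨ depth I η + s ≤ η ∨ depth I η = 0 := by
    simp only [depth]
    omega
  rcases h with h | h | h
  · have : (depth I η : ℝ) + η ≤ s := by exact_mod_cast h
    exact (le_sub_iff_add_le.2 this).trans (le_abs_self _)
  · have : (depth I η : ℝ) + s ≤ η := by exact_mod_cast h
    rw [abs_sub_comm]
    exact (le_sub_iff_add_le.2 this).trans (le_abs_self _)
  · simp [h]

/-- No change point of `f` other than `η` lies strictly between the ends of the interval `I`. -/
def Isolates (T : ℕ) (f : ℕ → ℝ) (I : ℕ × ℕ) (η : ℕ) : Prop :=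
  ∀ η' ∈ changePoints T f, I.1 < η' → η' < I.2 → η' = η

theorem Spaced.isolates {d : ℕ} (hd : Spaced T f d) {η : ℕ} (hη : η ∈ changePoints T f)
    {I : ℕ × ℕ} (hl : η ≤ I.1 + d) (hr : I.2 ≤ η + d) : Isolates T f I η := by
  intro η' hη' hlt hgt
  rcases lt_trichotomy η' η with h | h | h
  · have := hd.le_sub η' hη' η hη h
    omega
  · exact h
  · have := hd.le_sub η hη η' hη' h
    omega

namespace Isolates

variable {I : ℕ × ℕ} {η : ℕ}

theorem mono (h : Isolates T f I η) {I' : ℕ × ℕ} (hl : I.1 ≤ I'.1) (hr : I'.2 ≤ I.2) :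
    Isolates T f I' η :=
  fun η' hη' hlt hgt => h η' hη' (hl.trans_lt hlt) (hgt.trans_le hr)

theorem depth_eq_zero (h : Isolates T f I η) {η' : ℕ} (hη' : η' ∈ changePoints T f)
    (hne : η' ≠ η) : depth I η' = 0 :=
  Nat.eq_zero_of_not_pos fun hpos =>
    hne (h η' hη' (depth_pos.1 hpos).1 (depth_pos.1 hpos).2)

theorem eq_left (h : Isolates T f I η) (hT : I.2 ≤ T) (hη : η ≤ I.2) {t : ℕ}
    (ht : t ∈ Finset.Ioc I.1 η) : f t = f η := by
  obtain ⟨ht, ht'⟩ := Finset.mem_Ioc.1 ht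
  refine isPiecewiseConst_changePoints T f t η (by omega) ht' (by omega) fun η' hη' hmem => ?_
  obtain ⟨hlt, hgt⟩ := Finset.mem_Ico.1 hmem
  exact hgt.ne (h η' hη' (by omega) (by omega))

theorem eq_right (h : Isolates T f I η) (hT : I.2 ≤ T) (hη : I.1 ≤ η) {t : ℕ}
    (ht : t ∈ Finset.Ioc η I.2) : f t = f (η + 1) := by
  obtain ⟨ht, ht'⟩ := Finset.mem_Ioc.1 ht
  refine (isPiecewiseConst_changePoints T f (η + 1) t (by omega) ht (by omega)
    fun η' hη' hmem => ?_).symm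
  obtain ⟨hlt, hgt⟩ := Finset.mem_Ico.1 hmem
  exact (Nat.lt_of_succ_le hlt).ne' (h η' hη' (by omega) (by omega))

end Isolates

end Signal

/-! ### Residual sums of squares and CUSUM statistics -/

section SegmentRSS

variable {x : ℕ → ℝ} {p I : ℕ × ℕ} {s : ℕ}

/-- The residual sum of squares of the constant fit on the segment `(p.1, p.2]`. -/
noncomputable def segmentRSS (x : ℕ → ℝ) (p : ℕ × ℕ) : ℝ :=
  ∑ t ∈ Finset.Ioc p.1 p.2, (segmentMean x p - x t) ^ 2

theorem sum_Ioc_const {u v : ℕ} (huv : u ≤ v) (c : ℝ) :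
    ∑ _t ∈ Finset.Ioc u v, c = ((v : ℝ) - u) * c := by
  simp [Nat.cast_sub huv]

theorem mul_segmentMean (x : ℕ → ℝ) (hp : p.1 ≤ p.2) :
    ((p.2 : ℝ) - p.1) * segmentMean x p = ∑ t ∈ Finset.Ioc p.1 p.2, x t := by
  rcases hp.eq_or_lt with h | h
  · simp [h]
  · exact mul_div_cancel₀ _ (sub_ne_zero.2 (Nat.cast_lt.2 h).ne')

theorem segmentMean_eq_of_forall_eq (hp : p.1 < p.2) {c : ℝ}
    (h : ∀ t ∈ Finset.Ioc p.1 p.2, x t = c) : segmentMean x p = c := by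
  rw [segmentMean, Finset.sum_congr rfl h, sum_Ioc_const hp.le]
  exact mul_div_cancel_left₀ c (sub_ne_zero.2 (Nat.cast_lt.2 hp).ne')

theorem sum_sub_sq_eq (x : ℕ → ℝ) (hp : p.1 ≤ p.2) (c : ℝ) :
    ∑ t ∈ Finset.Ioc p.1 p.2, (x t - c) ^ 2 =
      segmentRSS x p + ((p.2 : ℝ) - p.1) * (segmentMean x p - c) ^ 2 := by
  have hcross : ∑ t ∈ Finset.Ioc p.1 p.2, (x t - segmentMean x p) = 0 := by
    rw [Finset.sum_sub_distrib, sum_Ioc_const hp, mul_segmentMean x hp, sub_self]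
  calc ∑ t ∈ Finset.Ioc p.1 p.2, (x t - c) ^ 2
    _ = ∑ t ∈ Finset.Ioc p.1 p.2, ((segmentMean x p - x t) ^ 2 +
          2 * (segmentMean x p - c) * (x t - segmentMean x p) + (segmentMean x p - c) ^ 2) :=
      Finset.sum_congr rfl fun t _ => by ring
    _ = segmentRSS x p + ((p.2 : ℝ) - p.1) * (segmentMean x p - c) ^ 2 := by
      rw [Finset.sum_add_distrib, Finset.sum_add_distrib, ← Finset.mul_sum, hcross,
        sum_Ioc_const hp, mul_zero, add_zero, segmentRSS]

theorem segmentRSS_nonneg (x : ℕ → ℝ) (p : ℕ × ℕ) : 0 ≤ segmentRSS x p :=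
  Finset.sum_nonneg fun _ _ => sq_nonneg _

theorem segmentRSS_le_sum_sub_sq (x : ℕ → ℝ) (hp : p.1 ≤ p.2) (c : ℝ) :
    segmentRSS x p ≤ ∑ t ∈ Finset.Ioc p.1 p.2, (x t - c) ^ 2 := by
  have hlen : (0 : ℝ) ≤ (p.2 : ℝ) - p.1 := sub_nonneg.2 (Nat.cast_le.2 hp)
  rw [sum_sub_sq_eq x hp]
  exact le_add_of_nonneg_right (by positivity)

theorem cusum_eq_mul_sub_segmentMean (x : ℕ → ℝ) (hs : s ∈ Finset.Ioo I.1 I.2) :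
    cusum x I s = √(((s : ℝ) - I.1) * ((I.2 : ℝ) - s) / ((I.2 : ℝ) - I.1)) *
      (segmentMean x (I.1, s) - segmentMean x (s, I.2)) := by
  obtain ⟨hl, hr⟩ := Finset.mem_Ioo.1 hs
  have hp : (0 : ℝ) < (s : ℝ) - I.1 := sub_pos.2 (Nat.cast_lt.2 hl)
  have hq : (0 : ℝ) < (I.2 : ℝ) - s := sub_pos.2 (Nat.cast_lt.2 hr)
  have hn : (0 : ℝ) < (I.2 : ℝ) - I.1 := by linarith
  have hleft : √(((I.2 : ℝ) - s) / (((I.2 : ℝ) - I.1) * ((s : ℝ) - I.1))) * ((s : ℝ) - I.1) =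
      √(((s : ℝ) - I.1) * ((I.2 : ℝ) - s) / ((I.2 : ℝ) - I.1)) := by
    rw [show ((s : ℝ) - I.1) * ((I.2 : ℝ) - s) / ((I.2 : ℝ) - I.1) =
        ((I.2 : ℝ) - s) / (((I.2 : ℝ) - I.1) * ((s : ℝ) - I.1)) * ((s : ℝ) - I.1) ^ 2 by field_simp,
      Real.sqrt_mul (by positivity), Real.sqrt_sq hp.le]
  have hright : √(((s : ℝ) - I.1) / (((I.2 : ℝ) - I.1) * ((I.2 : ℝ) - s))) * ((I.2 : ℝ) - s) =
      √(((s : ℝ) - I.1) * ((I.2 : ℝ) - s) / ((I.2 : ℝ) - I.1)) := by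
    rw [show ((s : ℝ) - I.1) * ((I.2 : ℝ) - s) / ((I.2 : ℝ) - I.1) =
        ((s : ℝ) - I.1) / (((I.2 : ℝ) - I.1) * ((I.2 : ℝ) - s)) * ((I.2 : ℝ) - s) ^ 2 by field_simp,
      Real.sqrt_mul (by positivity), Real.sqrt_sq hq.le]
  rw [cusum, ← mul_segmentMean (p := (I.1, s)) x hl.le, ← mul_segmentMean (p := (s, I.2)) x hr.le,
    ← mul_assoc, ← mul_assoc, hleft, hright, ← mul_sub]

theorem cusum_sq_eq (x : ℕ → ℝ) (hs : s ∈ Finset.Ioo I.1 I.2) :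
    cusum x I s ^ 2 = ((s : ℝ) - I.1) * ((I.2 : ℝ) - s) / ((I.2 : ℝ) - I.1) *
      (segmentMean x (I.1, s) - segmentMean x (s, I.2)) ^ 2 := by
  obtain ⟨hl, hr⟩ := Finset.mem_Ioo.1 hs
  have hp : (0 : ℝ) ≤ (s : ℝ) - I.1 := sub_nonneg.2 (Nat.cast_le.2 hl.le)
  have hq : (0 : ℝ) ≤ (I.2 : ℝ) - s := sub_nonneg.2 (Nat.cast_le.2 hr.le)
  have hn : (0 : ℝ) ≤ (I.2 : ℝ) - I.1 := by linarith
  rw [cusum_eq_mul_sub_segmentMean x hs, mul_pow, Real.sq_sqrt (by positivity)]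

theorem segmentRSS_eq_add_cusum_sq (x : ℕ → ℝ) (hs : s ∈ Finset.Ioo I.1 I.2) :
    segmentRSS x I = segmentRSS x (I.1, s) + segmentRSS x (s, I.2) + cusum x I s ^ 2 := by
  obtain ⟨hl, hr⟩ := Finset.mem_Ioo.1 hs
  have hn : (I.2 : ℝ) - I.1 ≠ 0 := sub_ne_zero.2 (Nat.cast_lt.2 (hl.trans hr)).ne'
  have hmean : segmentMean x I = (((s : ℝ) - I.1) * segmentMean x (I.1, s) +
      ((I.2 : ℝ) - s) * segmentMean x (s, I.2)) / ((I.2 : ℝ) - I.1) := by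
    rw [mul_segmentMean (p := (I.1, s)) x hl.le, mul_segmentMean (p := (s, I.2)) x hr.le,
      Finset.sum_Ioc_consecutive x hl.le hr.le, segmentMean]
  have hI := sum_sub_sq_eq x (hl.trans hr).le (segmentMean x I)
  rw [sub_self, zero_pow two_ne_zero, mul_zero, add_zero,
    ← Finset.sum_Ioc_consecutive _ hl.le hr.le, sum_sub_sq_eq (p := (I.1, s)) x hl.le,
    sum_sub_sq_eq (p := (s, I.2)) x hr.le] at hI
  rw [← hI, cusum_sq_eq x hs, hmean]
  field_simp
  ring

theorem cusum_sq_le_sum_sub_sq (x : ℕ → ℝ) (hs : s ∈ Finset.Ioo I.1 I.2) (c : ℝ) :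
    cusum x I s ^ 2 ≤ ∑ t ∈ Finset.Ioc I.1 I.2, (x t - c) ^ 2 := by
  have hI : I.1 ≤ I.2 := ((Finset.mem_Ioo.1 hs).1.trans (Finset.mem_Ioo.1 hs).2).le
  have := segmentRSS_eq_add_cusum_sq x hs
  linarith [segmentRSS_le_sum_sub_sq x hI c, segmentRSS_nonneg x (I.1, s),
    segmentRSS_nonneg x (s, I.2)]

theorem IsBestSplit.segmentRSS_add_le (hs : IsBestSplit x I s) {s' : ℕ}
    (hs' : s' ∈ Finset.Ioo I.1 I.2) :
    segmentRSS x (I.1, s) + segmentRSS x (s, I.2) ≤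
      segmentRSS x (I.1, s') + segmentRSS x (s', I.2) := by
  have hgain : cusum x I s' ^ 2 ≤ cusum x I s ^ 2 := sq_le_sq.2 (hs.2 s' hs')
  have := segmentRSS_eq_add_cusum_sq x hs.1
  have := segmentRSS_eq_add_cusum_sq x hs'
  linarith

end SegmentRSS

section Cusum

variable {T : ℕ} {f : ℕ → ℝ} {I : ℕ × ℕ} {s : ℕ}

theorem cusum_add (x y : ℕ → ℝ) (I : ℕ × ℕ) (s : ℕ) :
    cusum (fun t => x t + y t) I s = cusum x I s + cusum y I s := by
  simp only [cusum, Finset.sum_add_distrib]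
  ring

theorem cusum_sum {ι : Type*} (A : Finset ι) (x : ι → ℕ → ℝ) (I : ℕ × ℕ) (s : ℕ) :
    cusum (fun t => ∑ i ∈ A, x i t) I s = ∑ i ∈ A, cusum (x i) I s := by
  simp only [cusum, Finset.sum_sub_distrib, ← Finset.mul_sum]
  rw [Finset.sum_comm, Finset.sum_comm (s := Finset.Ioc s I.2)]

theorem cusum_congr {x y : ℕ → ℝ} (hs : s ∈ Finset.Ioo I.1 I.2)
    (h : ∀ t ∈ Finset.Ioc I.1 I.2, x t = y t) : cusum x I s = cusum y I s := by
  obtain ⟨hl, hr⟩ := Finset.mem_Ioo.1 hs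
  rw [cusum, cusum,
    Finset.sum_congr rfl fun t ht => h t (Finset.Ioc_subset_Ioc_right hr.le ht),
    Finset.sum_congr rfl fun t ht => h t (Finset.Ioc_subset_Ioc_left hl.le ht)]

theorem cusum_const (c : ℝ) (hs : s ∈ Finset.Ioo I.1 I.2) : cusum (fun _ => c) I s = 0 := by
  rw [cusum_eq_mul_sub_segmentMean _ hs,
    segmentMean_eq_of_forall_eq (Finset.mem_Ioo.1 hs).1 fun _ _ => rfl,
    segmentMean_eq_of_forall_eq (Finset.mem_Ioo.1 hs).2 fun _ _ => rfl, sub_self, mul_zero]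

-- The gain over a constant fit is at most the error of the better of the fits `0` and `c`.
theorem cusum_stepAt_sq_le (η : ℕ) (c : ℝ) (hs : s ∈ Finset.Ioo I.1 I.2) :
    cusum (stepAt η c) I s ^ 2 ≤ c ^ 2 * depth I η := by
  have hleft : ∑ t ∈ Finset.Ioc I.1 I.2, (stepAt η c t - c) ^ 2 ≤ c ^ 2 * (η - I.1 : ℕ) := calc
    _ = ∑ _t ∈ (Finset.Ioc I.1 I.2).filter (· ≤ η), c ^ 2 := by
      rw [Finset.sum_filter]
      refine Finset.sum_congr rfl fun t _ => ?_
      by_cases h : η < t <;> simp [stepAt, h, not_le, not_lt.1]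
    _ ≤ ∑ _t ∈ Finset.Ioc I.1 η, c ^ 2 :=
      Finset.sum_le_sum_of_subset_of_nonneg (fun t => by
        simp only [Finset.mem_filter, Finset.mem_Ioc]
        omega) fun _ _ _ => sq_nonneg c
    _ = c ^ 2 * (η - I.1 : ℕ) := by simp [mul_comm]
  have hright : ∑ t ∈ Finset.Ioc I.1 I.2, (stepAt η c t - 0) ^ 2 ≤ c ^ 2 * (I.2 - η : ℕ) := calc
    _ = ∑ _t ∈ (Finset.Ioc I.1 I.2).filter (η < ·), c ^ 2 := by
      rw [Finset.sum_filter]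
      exact Finset.sum_congr rfl fun t _ => by simp [stepAt]
    _ ≤ ∑ _t ∈ Finset.Ioc η I.2, c ^ 2 :=
      Finset.sum_le_sum_of_subset_of_nonneg (fun t => by
        simp only [Finset.mem_filter, Finset.mem_Ioc]
        omega) fun _ _ _ => sq_nonneg c
    _ = c ^ 2 * (I.2 - η : ℕ) := by simp [mul_comm]
  rw [depth, Nat.cast_min, mul_min_of_nonneg _ _ (sq_nonneg c)]
  exact le_min ((cusum_sq_le_sum_sub_sq _ hs c).trans hleft)
    ((cusum_sq_le_sum_sub_sq _ hs 0).trans hright)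

theorem abs_cusum_signal_le (hI : I.2 ≤ T) (hs : s ∈ Finset.Ioo I.1 I.2) {b : ℝ} (hb : 0 ≤ b)
    (h : ∀ η ∈ changePoints T f, jump f η ^ 2 * depth I η ≤ b ^ 2) :
    |cusum f I s| ≤ (changePoints T f).card * b := by
  have hdecomp : cusum f I s =
      ∑ η ∈ changePoints T f, cusum (stepAt η (f (η + 1) - f η)) I s := by
    rw [← cusum_sum, ← zero_add (cusum (fun t => ∑ η ∈ _, _) I s), ← cusum_const (f 1) hs,
      ← cusum_add]
    refine cusum_congr hs fun t ht => signal_eq_add_sum_stepAt ?_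
    rw [Finset.mem_Ioc] at ht
    exact Finset.mem_Icc.2 ⟨by omega, by omega⟩
  rw [hdecomp, ← nsmul_eq_mul]
  refine (Finset.abs_sum_le_sum_abs _ _).trans (Finset.sum_le_card_nsmul _ _ _ fun η hη => ?_)
  refine abs_le_of_sq_le_sq ((cusum_stepAt_sq_le η _ hs).trans ?_) hb
  rw [← jump_sq]
  exact h η hη

theorem Isolates.half_jump_sq_mul_depth_le_cusum_sq {η : ℕ} (h : Isolates T f I η)
    (hI : I.2 ≤ T) (hη : η ∈ Finset.Ioo I.1 I.2) :
    jump f η ^ 2 * depth I η / 2 ≤ cusum f I η ^ 2 := by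
  obtain ⟨hl, hr⟩ := Finset.mem_Ioo.1 hη
  have hp : (0 : ℝ) < (η : ℝ) - I.1 := sub_pos.2 (Nat.cast_lt.2 hl)
  have hq : (0 : ℝ) < (I.2 : ℝ) - η := sub_pos.2 (Nat.cast_lt.2 hr)
  have hdp : (depth I η : ℝ) ≤ (η : ℝ) - I.1 := by
    rw [← Nat.cast_sub hl.le]
    exact Nat.cast_le.2 (min_le_left _ _)
  have hdq : (depth I η : ℝ) ≤ (I.2 : ℝ) - η := by
    rw [← Nat.cast_sub hr.le]
    exact Nat.cast_le.2 (min_le_right _ _)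
  have hweight : (depth I η : ℝ) / 2 ≤ ((η : ℝ) - I.1) * ((I.2 : ℝ) - η) / ((I.2 : ℝ) - I.1) := by
    rw [div_le_div_iff₀ two_pos (by linarith)]
    nlinarith [mul_le_mul_of_nonneg_right hdp hq.le, mul_le_mul_of_nonneg_right hdq hp.le]
  rw [cusum_sq_eq f hη, segmentMean_eq_of_forall_eq hl fun t ht => h.eq_left hI hr.le ht,
    segmentMean_eq_of_forall_eq hr fun t ht => h.eq_right hI hl.le ht, jump_sq, mul_div_assoc,
    mul_comm, ← neg_sub, neg_sq]
  exact mul_le_mul_of_nonneg_right hweight (sq_nonneg _)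

end Cusum

/-! ### Controlled noise and a single change point -/

/-- The noise level of `x - f` on `{1, …, T}` is at most `w`: the squared sum of `x - f` over every
interval is at most `w` times the length of the interval. It replaces the Gaussian errors in the
deterministic part of the argument. -/
def NoiseControlled (T : ℕ) (f x : ℕ → ℝ) (w : ℝ) : Prop :=
  ∀ u v, u ≤ v → v ≤ T → (∑ t ∈ Finset.Ioc u v, (x t - f t)) ^ 2 ≤ w * ((v : ℝ) - u)

/-- The threshold with which narrowest-over-threshold selection finds all `N` change points if the
noise level is `w`. -/
noncomputable def threshold (N : ℕ) (w : ℝ) : ℝ := (6 * N + 2) * √w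

section Localization

variable {T : ℕ} {f x : ℕ → ℝ} {w : ℝ} {I : ℕ × ℕ} {s η : ℕ}

theorem Isolates.half_jump_sq_mul_depth_le_sum_sub_sq (h : Isolates T f I η) (hI : I.2 ≤ T)
    (c : ℝ) : jump f η ^ 2 * depth I η / 2 ≤ ∑ t ∈ Finset.Ioc I.1 I.2, (f t - c) ^ 2 := by
  by_cases hη : η ∈ Finset.Ioo I.1 I.2
  · exact (h.half_jump_sq_mul_depth_le_cusum_sq hI hη).trans (cusum_sq_le_sum_sub_sq f hη c)
  · have hzero : depth I η = 0 := Nat.eq_zero_of_not_pos fun hpos =>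
      hη (Finset.mem_Ioo.2 (depth_pos.1 hpos))
    rw [hzero, Nat.cast_zero, mul_zero, zero_div]
    exact Finset.sum_nonneg fun _ _ => sq_nonneg _

namespace NoiseControlled

theorem le_sum_sub_sq (hx : NoiseControlled T f x w) (hw : 0 ≤ w) {u v : ℕ} (huv : u ≤ v)
    (hv : v ≤ T) {g : ℕ → ℝ} {h : ℝ} (hg : ∀ t ∈ Finset.Ioc u v, f t - g t = h) :
    ∑ t ∈ Finset.Ioc u v, (x t - f t) ^ 2 + (∑ t ∈ Finset.Ioc u v, (f t - g t) ^ 2) / 2 - 2 * w ≤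
      ∑ t ∈ Finset.Ioc u v, (x t - g t) ^ 2 := by
  set n : ℝ := (v : ℝ) - u
  have hn : 0 ≤ n := sub_nonneg.2 (Nat.cast_le.2 huv)
  set E := ∑ t ∈ Finset.Ioc u v, (x t - f t)
  have hE : E ^ 2 ≤ w * n := hx u v huv hv
  have hsq : ∑ t ∈ Finset.Ioc u v, (f t - g t) ^ 2 = n * h ^ 2 := by
    rw [Finset.sum_congr rfl fun t ht => by rw [hg t ht], sum_Ioc_const huv]
  have hexpand : ∑ t ∈ Finset.Ioc u v, (x t - g t) ^ 2 =
      ∑ t ∈ Finset.Ioc u v, (x t - f t) ^ 2 + 2 * h * E + n * h ^ 2 := by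
    rw [← hsq, Finset.mul_sum, ← Finset.sum_add_distrib, ← Finset.sum_add_distrib]
    refine Finset.sum_congr rfl fun t ht => ?_
    rw [← hg t ht]
    ring
  have hcross : (2 * h * E) ^ 2 ≤ (n * h ^ 2 / 2 + 2 * w) ^ 2 := by
    nlinarith [sq_nonneg (n * h ^ 2 / 2 - 2 * w), mul_le_mul_of_nonneg_left hE (sq_nonneg h)]
  rw [hexpand, hsq]
  linarith [neg_le_of_abs_le (abs_le_of_sq_le_sq hcross (by positivity))]

theorem add_jump_sq_mul_depth_le_segmentRSS (hx : NoiseControlled T f x w) (hw : 0 ≤ w)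
    (hI : I.1 ≤ I.2) (hIT : I.2 ≤ T) (hη : Isolates T f I η) :
    ∑ t ∈ Finset.Ioc I.1 I.2, (x t - f t) ^ 2 + jump f η ^ 2 * depth I η / 4 - 4 * w ≤
      segmentRSS x I := by
  obtain ⟨e, hl, hr, he⟩ : ∃ e, I.1 ≤ e ∧ e ≤ I.2 ∧ Isolates T f I e := by
    by_cases h : I.1 ≤ η ∧ η ≤ I.2
    · exact ⟨η, h.1, h.2, hη⟩
    · refine ⟨I.1, le_rfl, hI, fun η' hη' hlt hgt => ?_⟩
      have := hη η' hη' hlt hgt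
      omega
  set c := segmentMean x I
  have hleft := hx.le_sum_sub_sq hw hl (hr.trans hIT) (g := fun _ => c) fun t ht => by
    rw [he.eq_left hIT hr ht]
  have hright := hx.le_sum_sub_sq hw hr hIT (g := fun _ => c) fun t ht => by
    rw [he.eq_right hIT hl ht]
  have hjump := hη.half_jump_sq_mul_depth_le_sum_sub_sq hIT c
  have hrss : segmentRSS x I = ∑ t ∈ Finset.Ioc I.1 I.2, (x t - c) ^ 2 :=
    Finset.sum_congr rfl fun t _ => sub_sq_comm _ _
  rw [← Finset.sum_Ioc_consecutive _ hl hr] at hrss hjump ⊢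
  linarith

theorem abs_cusum_sub_le (hx : NoiseControlled T f x w) (hw : 0 ≤ w) (hI : I.2 ≤ T)
    (hs : s ∈ Finset.Ioo I.1 I.2) : |cusum x I s - cusum f I s| ≤ 2 * √w := by
  obtain ⟨hl, hr⟩ := Finset.mem_Ioo.1 hs
  have hscaled : ∀ {p q E : ℝ}, 0 < p → 0 < q → E ^ 2 ≤ w * p →
      |√(q / ((p + q) * p)) * E| ≤ √w := by
    intro p q E hp hq hE
    refine Real.abs_le_sqrt ?_
    rw [mul_pow, Real.sq_sqrt (by positivity)]
    calc q / ((p + q) * p) * E ^ 2 ≤ q / ((p + q) * p) * (w * p) := by gcongr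
      _ = w * (q / (p + q)) := by field_simp
      _ ≤ w := mul_le_of_le_one_right hw ((div_le_one (by positivity)).2 (by linarith))
  have hp : (0 : ℝ) < (s : ℝ) - I.1 := sub_pos.2 (Nat.cast_lt.2 hl)
  have hq : (0 : ℝ) < (I.2 : ℝ) - s := sub_pos.2 (Nat.cast_lt.2 hr)
  have hleft := hscaled hp hq (hx I.1 s hl.le (hr.le.trans hI))
  have hright := hscaled hq hp (hx s I.2 hr.le hI)
  rw [sub_add_sub_cancel'] at hleft
  rw [sub_add_sub_cancel] at hright
  have herror : cusum x I s - cusum f I s = cusum (fun t => x t - f t) I s := by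
    rw [sub_eq_iff_eq_add, ← cusum_add]
    simp only [sub_add_cancel]
  rw [herror, cusum, two_mul]
  exact (abs_sub _ _).trans (add_le_add hleft hright)

theorem abs_cusum_le_threshold (hx : NoiseControlled T f x w) (hw : 0 ≤ w) (hI : I.2 ≤ T)
    (hs : s ∈ Finset.Ioo I.1 I.2)
    (h : ∀ η ∈ changePoints T f, jump f η ^ 2 * depth I η ≤ 36 * w) :
    |cusum x I s| ≤ threshold (changePoints T f).card w := by
  have hsignal := abs_cusum_signal_le (b := 6 * √w) hI hs (by positivity) fun η hη =>
    (h η hη).trans_eq (by rw [mul_pow, Real.sq_sqrt hw]; norm_num)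
  rw [threshold]
  linarith [hx.abs_cusum_sub_le hw hI hs, abs_sub_abs_le_abs_sub (cusum x I s) (cusum f I s)]

end NoiseControlled

theorem exists_isBestSplit (x : ℕ → ℝ) (hs : s ∈ Finset.Ioo I.1 I.2) :
    ∃ s, IsBestSplit x I s :=
  Finset.exists_max_image _ (fun s => |cusum x I s|) ⟨s, hs⟩

theorem OverThreshold.lt_abs_cusum {κ : ℝ} (h : OverThreshold x κ I) (hs : IsBestSplit x I s) :
    κ < |cusum x I s| := by
  obtain ⟨s', hs', hlt⟩ := h
  exact hlt.trans_le (hs.2 s' hs'.1)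

theorem NoiseControlled.overThreshold (hx : NoiseControlled T f x w) (hw : 0 ≤ w) (hI : I.2 ≤ T)
    (hη : Isolates T f I η)
    (hgain : 72 * ((changePoints T f).card + 1) ^ 2 * w < jump f η ^ 2 * depth I η) :
    OverThreshold x (threshold (changePoints T f).card w) I := by
  set N := (changePoints T f).card
  have hmem : η ∈ Finset.Ioo I.1 I.2 := by
    refine Finset.mem_Ioo.2 (depth_pos.1 (Nat.pos_of_ne_zero fun h0 => ?_))
    rw [h0, Nat.cast_zero, mul_zero] at hgain
    exact hgain.not_ge (by positivity)
  have hsignal : 6 * (N + 1) * √w < |cusum f I η| := by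
    refine lt_of_pow_lt_pow_left₀ 2 (abs_nonneg _) ?_
    rw [sq_abs, mul_pow, Real.sq_sqrt hw]
    linarith [hη.half_jump_sq_mul_depth_le_cusum_sq hI hmem]
  obtain ⟨s, hs⟩ := exists_isBestSplit x hmem
  refine ⟨s, hs, ?_⟩
  have hnoise := hx.abs_cusum_sub_le hw hI hmem
  rw [abs_sub_comm] at hnoise
  rw [threshold]
  linarith [hs.2 η hmem, abs_sub_abs_le_abs_sub (cusum f I η) (cusum x I η), Real.sqrt_nonneg w]

/-- The location `s` is within the distance `B / δ ^ 2` of `η`, where `δ` is the jump at `η`. -/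
def NearChangePoint (f : ℕ → ℝ) (B : ℝ) (s η : ℕ) : Prop :=
  jump f η ^ 2 * |(s : ℝ) - η| ≤ B

theorem NearChangePoint.two_mul_lt {B : ℝ} {d : ℕ} (hs : NearChangePoint f B s η)
    (hd : 2 * B < jump f η ^ 2 * d) : 2 * s < 2 * η + d ∧ 2 * η < 2 * s + d := by
  have hdist : 2 * |(s : ℝ) - η| < d :=
    lt_of_mul_lt_mul_left (a := jump f η ^ 2) (by unfold NearChangePoint at hs; linarith)
      (sq_nonneg _)
  constructor
  · exact_mod_cast (by linarith [le_abs_self ((s : ℝ) - η)] : (2 * s : ℝ) < 2 * η + d)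
  · exact_mod_cast (by linarith [neg_abs_le ((s : ℝ) - η)] : (2 * η : ℝ) < 2 * s + d)

/-- A best split far from `η` would leave `η` deep inside one of the two parts, which costs more
than the split at `η` itself. -/
theorem IsBestSplit.jump_sq_mul_depth_add_le (hs : IsBestSplit x I s)
    (hx : NoiseControlled T f x w) (hw : 0 ≤ w) (hI : I.2 ≤ T) (hη : Isolates T f I η)
    (hmem : η ∈ Finset.Ioo I.1 I.2) :
    jump f η ^ 2 * (depth (I.1, s) η + depth (s, I.2) η : ℕ) ≤ 32 * w := by
  obtain ⟨hl, hr⟩ := Finset.mem_Ioo.1 hs.1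
  obtain ⟨hηl, hηr⟩ := Finset.mem_Ioo.1 hmem
  have hupper : segmentRSS x (I.1, η) + segmentRSS x (η, I.2) ≤
      ∑ t ∈ Finset.Ioc I.1 I.2, (x t - f t) ^ 2 := by
    rw [← Finset.sum_Ioc_consecutive _ hηl.le hηr.le,
      Finset.sum_congr rfl fun t ht => by rw [hη.eq_left hI hηr.le ht],
      Finset.sum_congr (s₁ := Finset.Ioc η I.2) rfl fun t ht => by rw [hη.eq_right hI hηl.le ht]]
    exact add_le_add (segmentRSS_le_sum_sub_sq x hηl.le _) (segmentRSS_le_sum_sub_sq x hηr.le _)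
  have hlowerLeft := hx.add_jump_sq_mul_depth_le_segmentRSS (I := (I.1, s)) hw hl.le
    (hr.le.trans hI) (hη.mono le_rfl hr.le)
  have hlowerRight := hx.add_jump_sq_mul_depth_le_segmentRSS (I := (s, I.2)) hw hr.le hI
    (hη.mono hl.le le_rfl)
  have hbest := hs.segmentRSS_add_le hmem
  rw [← Finset.sum_Ioc_consecutive _ hl.le hr.le] at hupper
  rw [Nat.cast_add, mul_add]
  linarith

theorem IsBestSplit.nearChangePoint (hs : IsBestSplit x I s) (hx : NoiseControlled T f x w)
    (hw : 0 ≤ w) (hI : I.2 ≤ T) (hη : Isolates T f I η) (hmem : η ∈ Finset.Ioo I.1 I.2)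
    (hover : threshold (changePoints T f).card w < |cusum x I s|) :
    NearChangePoint f (36 * w) s η := by
  have hdeep : 36 * w < jump f η ^ 2 * depth I η := by
    by_contra! hshallow
    refine hover.not_ge (hx.abs_cusum_le_threshold hw hI hs.1 fun η' hη' => ?_)
    rcases eq_or_ne η' η with rfl | hne
    · exact hshallow
    · rw [hη.depth_eq_zero hη' hne, Nat.cast_zero, mul_zero]
      positivity
  have hparts := hs.jump_sq_mul_depth_add_le hx hw hI hη hmem
  set D := depth (I.1, s) η + depth (s, I.2) η with hD
  have hcover : depth I η ≤ D ∨ s ≤ η + D ∧ η ≤ s + D := by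
    have := Finset.mem_Ioo.1 hs.1
    simp only [hD, depth]
    omega
  rcases hcover with hle | ⟨hle, hge⟩
  · have : jump f η ^ 2 * depth I η ≤ jump f η ^ 2 * D := by gcongr
    linarith
  · have habs : |(s : ℝ) - η| ≤ D := by
      have : (s : ℝ) ≤ η + D := by exact_mod_cast hle
      have : (η : ℝ) ≤ s + D := by exact_mod_cast hge
      exact abs_sub_le_iff.2 ⟨by linarith, by linarith⟩
    calc jump f η ^ 2 * |(s : ℝ) - η| ≤ jump f η ^ 2 * D := by gcongr
      _ ≤ 36 * w := by linarith

end Localization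

/-! ### Narrowest-over-threshold selection -/

section Selection

variable {T d : ℕ} {f x : ℕ → ℝ} {w B : ℝ} {good : ℕ → ℕ × ℕ} {D S : Finset ℕ}
  {J : Finset (ℕ × ℕ)} {s η : ℕ}

theorem NOTSelects.subset {κ : ℝ} (h : NOTSelects x κ J S) (hJ : ∀ I ∈ J, I.2 ≤ T) :
    S ⊆ Finset.Ioo 0 T := by
  induction h with
  | done _ => exact Finset.empty_subset _
  | @step J S I s mem _ _ best _ ih =>
    obtain ⟨hl, hr⟩ := Finset.mem_Ioo.1 best.1
    exact Finset.insert_subset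
      (Finset.mem_Ioo.2 ⟨(Nat.zero_le _).trans_lt hl, hr.trans_le (hJ I mem)⟩)
      (ih fun I' hI' => hJ I' (Finset.mem_filter.1 hI').1)

/-- The invariant of narrowest-over-threshold selection: the remaining intervals `J` still contain
the designated interval `good η` of every change point `η` outside the set `D`, while each change
point in `D` has an estimate within `B / δ ^ 2` that belongs to no interval of `J`. -/
structure SelectionInvariant (T : ℕ) (f : ℕ → ℝ) (B : ℝ) (good : ℕ → ℕ × ℕ) (D : Finset ℕ)
    (J : Finset (ℕ × ℕ)) : Prop where
  snd_le : ∀ I ∈ J, I.2 ≤ T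
  subset : D ⊆ changePoints T f
  good_mem : ∀ η ∈ changePoints T f, η ∉ D → good η ∈ J
  exists_near : ∀ η ∈ D, ∃ s, NearChangePoint f B s η ∧ ∀ I ∈ J, ¬(I.1 < s ∧ s ≤ I.2)

namespace SelectionInvariant

theorem exists_mem_Ioo (h : SelectionInvariant T f (36 * w) good D J)
    (hx : NoiseControlled T f x w) (hw : 0 ≤ w) {I : ℕ × ℕ} (hI : I ∈ J)
    (hs : s ∈ Finset.Ioo I.1 I.2) (hover : threshold (changePoints T f).card w < |cusum x I s|) :
    ∃ η ∈ changePoints T f, η ∉ D ∧ η ∈ Finset.Ioo I.1 I.2 := by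
  by_contra! hall
  refine hover.not_ge (hx.abs_cusum_le_threshold hw (h.snd_le I hI) hs fun η hη => ?_)
  by_cases hηD : η ∈ D
  · obtain ⟨s', hnear, hout⟩ := h.exists_near η hηD
    exact (mul_le_mul_of_nonneg_left (depth_le_abs_sub (hout I hI) η) (sq_nonneg _)).trans hnear
  · have hzero : depth I η = 0 := Nat.eq_zero_of_not_pos fun hpos =>
      hall η hη hηD (Finset.mem_Ioo.2 (depth_pos.1 hpos))
    rw [hzero, Nat.cast_zero, mul_zero]
    positivity

theorem insert_filter (h : SelectionInvariant T f B good D J) (hd : Spaced T f d)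
    (hmem : ∀ η ∈ changePoints T f, η ∈ Finset.Ioo (good η).1 (good η).2)
    (hlen : ∀ η ∈ changePoints T f, 2 * ((good η).2 - (good η).1) ≤ d)
    (hη : η ∈ changePoints T f) (hnear : NearChangePoint f B s η)
    (hB : 2 * B < jump f η ^ 2 * d) :
    SelectionInvariant T f B good (insert η D) (J.filter fun I => ¬(I.1 < s ∧ s ≤ I.2)) where
  snd_le I hI := h.snd_le I (Finset.mem_filter.1 hI).1
  subset := Finset.insert_subset hη h.subset
  good_mem η' hη' hnot := by
    rw [Finset.mem_insert, not_or] at hnot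
    refine Finset.mem_filter.2 ⟨h.good_mem η' hη' hnot.2, ?_⟩
    have hclose := hnear.two_mul_lt hB
    have hmem' := Finset.mem_Ioo.1 (hmem η' hη')
    have hlen' := hlen η' hη'
    rcases lt_or_gt_of_ne hnot.1 with hlt | hlt
    · have := hd.le_sub η' hη' η hη hlt
      omega
    · have := hd.le_sub η hη η' hη' hlt
      omega
  exists_near η' hη' := by
    rcases Finset.mem_insert.1 hη' with rfl | hη'
    · exact ⟨s, hnear, fun I hI => (Finset.mem_filter.1 hI).2⟩
    · obtain ⟨s', hnear', hout⟩ := h.exists_near η' hη'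
      exact ⟨s', hnear', fun I hI => hout I (Finset.mem_filter.1 hI).1⟩

end SelectionInvariant

/-- The selected interval is no longer than the designated interval of a change point it contains,
hence it contains no second change point; so every step detects exactly one new change point. -/
theorem NOTSelects.card_add_card_le (hx : NoiseControlled T f x w) (hw : 0 ≤ w)
    (hd : Spaced T f d) (hdw : ∀ η ∈ changePoints T f, 72 * w < jump f η ^ 2 * d)
    (hmem : ∀ η ∈ changePoints T f, η ∈ Finset.Ioo (good η).1 (good η).2)
    (hlen : ∀ η ∈ changePoints T f, 2 * ((good η).2 - (good η).1) ≤ d)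
    (hgood : ∀ η ∈ changePoints T f, OverThreshold x (threshold (changePoints T f).card w) (good η))
    (hJ : SelectionInvariant T f (36 * w) good D J)
    (h : NOTSelects x (threshold (changePoints T f).card w) J S) :
    S.card + D.card ≤ (changePoints T f).card ∧
      ∀ η ∈ changePoints T f, η ∉ D → ∃ s ∈ S, NearChangePoint f (36 * w) s η := by
  induction h generalizing D with
  | done none_over =>
    refine ⟨by simpa using Finset.card_le_card hJ.subset, fun η hη hηD => ?_⟩
    exact absurd (hgood η hη) (none_over _ (hJ.good_mem η hη hηD))
  | @step J S I s mem is_over narrowest best _ ih =>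
    have hgain := is_over.lt_abs_cusum best
    obtain ⟨η, hη, hηD, hηI⟩ := hJ.exists_mem_Ioo hx hw mem best.1 hgain
    have hshort : 2 * (I.2 - I.1) ≤ d := by
      have := narrowest _ (hJ.good_mem η hη hηD) (hgood η hη)
      have := hlen η hη
      omega
    have hiso : Isolates T f I η := by
      have := Finset.mem_Ioo.1 hηI
      exact hd.isolates hη (by omega) (by omega)
    have hnear := best.nearChangePoint hx hw (hJ.snd_le I mem) hiso hηI hgain
    obtain ⟨hcard, hfound⟩ := ih (hJ.insert_filter hd hmem hlen hη hnear
      (by linarith [hdw η hη]))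
    rw [Finset.card_insert_of_notMem hηD] at hcard
    refine ⟨by have := Finset.card_insert_le s S; omega, fun η' hη' hη'D => ?_⟩
    by_cases heq : η' = η
    · exact ⟨s, Finset.mem_insert_self _ _, heq ▸ hnear⟩
    · obtain ⟨s', hs', hnear'⟩ := hfound η' hη' (by simp [heq, hη'D])
      exact ⟨s', Finset.mem_insert_of_mem hs', hnear'⟩

end Selection

/-! ### Piecewise constant fits -/

section Fit

variable {T : ℕ} {S : Finset ℕ} {p q : ℕ × ℕ} {t : ℕ}

theorem le_of_mem_insert (hS : S ⊆ Finset.Ioo 0 T) {e : ℕ} (he : e ∈ insert 0 (insert T S)) :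
    e ≤ T := by
  rcases Finset.mem_insert.1 he with rfl | he
  · exact Nat.zero_le T
  rcases Finset.mem_insert.1 he with rfl | he
  · exact le_rfl
  · exact (Finset.mem_Ioo.1 (hS he)).2.le

theorem snd_le_of_mem_segments (hS : S ⊆ Finset.Ioo 0 T) (hp : p ∈ segments T S) : p.2 ≤ T :=
  le_of_mem_insert hS (mem_segments.1 hp).1.2

theorem notMem_Ioo_of_mem_segments (hS : S ⊆ Finset.Ioo 0 T) (hp : p ∈ segments T S) {e : ℕ}
    (he : e ∈ insert 0 (insert T S)) : ¬(p.1 < e ∧ e < p.2) := by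
  have := snd_le_of_mem_segments hS hp
  rcases Finset.mem_insert.1 he with rfl | he
  · omega
  rcases Finset.mem_insert.1 he with rfl | he
  · omega
  · exact (mem_segments.1 hp).2.2 e he

theorem eq_of_mem_segments (hS : S ⊆ Finset.Ioo 0 T) (hp : p ∈ segments T S)
    (hq : q ∈ segments T S) (htp : t ∈ Finset.Ioc p.1 p.2) (htq : t ∈ Finset.Ioc q.1 q.2) :
    p = q := by
  rw [Finset.mem_Ioc] at htp htq
  obtain ⟨hp₁, hp₂⟩ := (mem_segments.1 hp).1
  obtain ⟨hq₁, hq₂⟩ := (mem_segments.1 hq).1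
  have := notMem_Ioo_of_mem_segments hS hp hq₁
  have := notMem_Ioo_of_mem_segments hS hp hq₂
  have := notMem_Ioo_of_mem_segments hS hq hp₁
  have := notMem_Ioo_of_mem_segments hS hq hp₂
  exact Prod.ext (by omega) (by omega)

theorem exists_mem_segments (S : Finset ℕ) (ht : t ∈ Finset.Ioc 0 T) :
    ∃ p ∈ segments T S, t ∈ Finset.Ioc p.1 p.2 := by
  rw [Finset.mem_Ioc] at ht
  obtain ⟨u, hu, hmax⟩ := ((insert 0 (insert T S)).filter (· < t)).exists_max_image id
    ⟨0, Finset.mem_filter.2 ⟨by simp, ht.1⟩⟩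
  obtain ⟨v, hv, hmin⟩ := ((insert 0 (insert T S)).filter (t ≤ ·)).exists_min_image id
    ⟨T, Finset.mem_filter.2 ⟨by simp, ht.2⟩⟩
  rw [Finset.mem_filter] at hu hv
  refine ⟨(u, v), mem_segments.2 ⟨⟨hu.1, hv.1⟩, hu.2.trans_le hv.2, fun s hs h => ?_⟩,
    Finset.mem_Ioc.2 ⟨hu.2, hv.2⟩⟩
  have hs' : s ∈ insert 0 (insert T S) := by simp [hs]
  rcases lt_or_ge s t with hst | hts
  · exact h.1.not_ge (hmax s (Finset.mem_filter.2 ⟨hs', hst⟩))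
  · exact h.2.not_ge (hmin s (Finset.mem_filter.2 ⟨hs', hts⟩))

theorem sum_segments (hS : S ⊆ Finset.Ioo 0 T) (F : ℕ → ℝ) :
    ∑ p ∈ segments T S, ∑ t ∈ Finset.Ioc p.1 p.2, F t = ∑ t ∈ Finset.Ioc 0 T, F t := by
  have hcover : Finset.Ioc 0 T = (segments T S).biUnion fun p => Finset.Ioc p.1 p.2 := by
    ext t
    refine ⟨fun ht => Finset.mem_biUnion.2 (exists_mem_segments S ht), fun ht => ?_⟩
    obtain ⟨p, hp, ht⟩ := Finset.mem_biUnion.1 ht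
    exact Finset.Ioc_subset_Ioc (Nat.zero_le _) (snd_le_of_mem_segments hS hp) ht
  rw [hcover, Finset.sum_biUnion]
  exact fun p hp q hq hpq =>
    Finset.disjoint_left.2 fun t htp htq => hpq (eq_of_mem_segments hS hp hq htp htq)

theorem card_segments_le (hS : S ⊆ Finset.Ioo 0 T) : (segments T S).card ≤ S.card + 1 := by
  refine le_trans ?_ (Finset.card_insert_le 0 S)
  refine Finset.card_le_card_of_injOn Prod.fst (fun p hp => ?_) fun p hp q hq hpq => ?_
  · obtain ⟨⟨hp₁, -⟩, hlt, -⟩ := mem_segments.1 hp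
    have hne : p.1 ≠ T := (hlt.trans_le (snd_le_of_mem_segments hS hp)).ne
    simpa [hne] using hp₁
  · have hplt := (mem_segments.1 hp).2.1
    have hqlt := (mem_segments.1 hq).2.1
    exact eq_of_mem_segments (t := p.1 + 1) hS hp hq (Finset.mem_Ioc.2 ⟨by omega, by omega⟩)
      (Finset.mem_Ioc.2 ⟨by omega, by omega⟩)

theorem IsPiecewiseConst.mono {S' : Finset ℕ} {g : ℕ → ℝ} (hg : IsPiecewiseConst T S g)
    (h : S ⊆ S') : IsPiecewiseConst T S' g :=
  fun t t' ht htt' ht' hs => hg t t' ht htt' ht' fun s hsS => hs s (h hsS)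

theorem IsPiecewiseConst.eq_on_segment {g : ℕ → ℝ} (hg : IsPiecewiseConst T S g)
    (hS : S ⊆ Finset.Ioo 0 T) (hp : p ∈ segments T S) (ht : t ∈ Finset.Ioc p.1 p.2) :
    g t = g p.2 := by
  obtain ⟨hpt, htp⟩ := Finset.mem_Ioc.1 ht
  refine hg t p.2 (Nat.one_le_of_lt hpt) htp (snd_le_of_mem_segments hS hp) fun s hs hmem => ?_
  obtain ⟨hts, hsp⟩ := Finset.mem_Ico.1 hmem
  exact (mem_segments.1 hp).2.2 s hs ⟨hpt.trans_le hts, hsp⟩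

theorem rss_le_sum_sub_sq (x : ℕ → ℝ) (hS : S ⊆ Finset.Ioo 0 T) {g : ℕ → ℝ}
    (hg : IsPiecewiseConst T S g) : rss T x S ≤ ∑ t ∈ Finset.Ioc 0 T, (x t - g t) ^ 2 := by
  rw [← sum_segments hS]
  refine Finset.sum_le_sum fun p hp => ?_
  calc segmentRSS x p ≤ ∑ t ∈ Finset.Ioc p.1 p.2, (x t - g p.2) ^ 2 :=
      segmentRSS_le_sum_sub_sq x (mem_segments.1 hp).2.1.le _
    _ = ∑ t ∈ Finset.Ioc p.1 p.2, (x t - g t) ^ 2 :=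
      Finset.sum_congr rfl fun t ht => by rw [hg.eq_on_segment hS hp ht]

/-- The fit to the data by segment means, whose residual sum of squares is `rss T x S`. The sum has
a single nonzero term if `t ∈ {1, …, T}`. -/
noncomputable def segmentMeanFit (T : ℕ) (x : ℕ → ℝ) (S : Finset ℕ) (t : ℕ) : ℝ :=
  ∑ p ∈ segments T S with t ∈ Finset.Ioc p.1 p.2, segmentMean x p

theorem segmentMeanFit_eq (x : ℕ → ℝ) (hS : S ⊆ Finset.Ioo 0 T) (hp : p ∈ segments T S)
    (ht : t ∈ Finset.Ioc p.1 p.2) : segmentMeanFit T x S t = segmentMean x p := by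
  have hsingle : {q ∈ segments T S | t ∈ Finset.Ioc q.1 q.2} = {p} := by
    refine Finset.eq_singleton_iff_unique_mem.2 ⟨Finset.mem_filter.2 ⟨hp, ht⟩, fun q hq => ?_⟩
    rw [Finset.mem_filter] at hq
    exact eq_of_mem_segments hS hq.1 hp hq.2 ht
  rw [segmentMeanFit, hsingle, Finset.sum_singleton]

theorem isPiecewiseConst_segmentMeanFit (x : ℕ → ℝ) (hS : S ⊆ Finset.Ioo 0 T) :
    IsPiecewiseConst T S (segmentMeanFit T x S) := by
  intro t t' ht htt' ht' hno
  obtain ⟨p, hp, htp⟩ := exists_mem_segments S (Finset.mem_Ioc.2 ⟨ht, htt'.trans ht'⟩)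
  obtain ⟨hpt, htp'⟩ := Finset.mem_Ioc.1 htp
  have hend : t' ≤ p.2 := by
    by_contra! hlt
    rcases Finset.mem_insert.1 (mem_segments.1 hp).1.2 with h0 | hend
    · omega
    rcases Finset.mem_insert.1 hend with hT | hend
    · omega
    · exact hno p.2 hend (Finset.mem_Ico.2 ⟨htp', hlt⟩)
  rw [segmentMeanFit_eq x hS hp htp,
    segmentMeanFit_eq x hS hp (Finset.mem_Ioc.2 ⟨hpt.trans_le htt', hend⟩)]

theorem rss_eq_sum_sub_segmentMeanFit_sq (x : ℕ → ℝ) (hS : S ⊆ Finset.Ioo 0 T) :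
    rss T x S = ∑ t ∈ Finset.Ioc 0 T, (x t - segmentMeanFit T x S t) ^ 2 := by
  rw [rss, ← sum_segments hS]
  refine Finset.sum_congr rfl fun p hp => Finset.sum_congr rfl fun t ht => ?_
  rw [segmentMeanFit_eq x hS hp ht, sub_sq_comm]

end Fit

section Comparison

variable {T d : ℕ} {f g x : ℕ → ℝ} {w B : ℝ} {S : Finset ℕ} {η : ℕ}

theorem changePoints_subset (T : ℕ) (f : ℕ → ℝ) : changePoints T f ⊆ Finset.Ioo 0 T := by
  intro t ht
  obtain ⟨h1, hT, -⟩ := mem_changePoints.1 ht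
  exact Finset.mem_Ioo.2 ⟨h1, hT⟩

theorem NoiseControlled.le_sum_sub_sq_of_isPiecewiseConst (hx : NoiseControlled T f x w)
    (hw : 0 ≤ w) (hS : S ⊆ Finset.Ioo 0 T) (hg : IsPiecewiseConst T S g) :
    ∑ t ∈ Finset.Ioc 0 T, (x t - f t) ^ 2 + (∑ t ∈ Finset.Ioc 0 T, (f t - g t) ^ 2) / 2 -
        2 * w * (S.card + (changePoints T f).card + 1) ≤
      ∑ t ∈ Finset.Ioc 0 T, (x t - g t) ^ 2 := by
  set U := S ∪ changePoints T f
  have hU : U ⊆ Finset.Ioo 0 T := Finset.union_subset hS (changePoints_subset T f)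
  have hcard : ((segments T U).card : ℝ) ≤ S.card + (changePoints T f).card + 1 := by
    exact_mod_cast (card_segments_le hU).trans (Nat.succ_le_succ (Finset.card_union_le _ _))
  have hgU : IsPiecewiseConst T U g := hg.mono Finset.subset_union_left
  have hfU : IsPiecewiseConst T U f :=
    (isPiecewiseConst_changePoints T f).mono Finset.subset_union_right
  have hsum := Finset.sum_le_sum fun p (hp : p ∈ segments T U) =>
    hx.le_sum_sub_sq hw (mem_segments.1 hp).2.1.le (snd_le_of_mem_segments hU hp)
      (g := g) (h := f p.2 - g p.2) fun t ht => by
        rw [hgU.eq_on_segment hU hp ht, hfU.eq_on_segment hU hp ht]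
  rw [Finset.sum_sub_distrib, Finset.sum_add_distrib, ← Finset.sum_div, sum_segments hU,
    sum_segments hU, sum_segments hU, Finset.sum_const, nsmul_eq_mul] at hsum
  nlinarith [mul_le_mul_of_nonneg_right hcard hw]

theorem Spaced.jump_sq_mul_le_sum_sub_sq (hd : Spaced T f d) (hη : η ∈ changePoints T f)
    (hg : IsPiecewiseConst T S g) {k : ℕ} (hk : k ≤ d)
    (hfar : ∀ s ∈ S, s ∉ Finset.Ioo (η - k) (η + k)) :
    jump f η ^ 2 * k ≤ 2 * ∑ t ∈ Finset.Ioc 0 T, (f t - g t) ^ 2 := by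
  have hl := hd.le_left η hη
  have hr := hd.le_right η hη
  have hpos := (mem_changePoints.1 hη).1
  have hiso : Isolates T f (η - k, η + k) η := hd.isolates hη (by simp only; omega)
    (by simp only; omega)
  have hdepth : depth (η - k, η + k) η = k := by simp only [depth]; omega
  have hconst : ∀ t ∈ Finset.Ioc (η - k) (η + k), g t = g η := by
    intro t ht
    obtain ⟨htl, htr⟩ := Finset.mem_Ioc.1 ht
    rcases le_total t η with hle | hle
    · refine hg t η (by omega) hle (by omega) fun s hs hmem => hfar s hs ?_
      rw [Finset.mem_Ico] at hmem
      exact Finset.mem_Ioo.2 ⟨by omega, by omega⟩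
    · refine (hg η t hpos hle (by omega) fun s hs hmem => hfar s hs ?_).symm
      rw [Finset.mem_Ico] at hmem
      exact Finset.mem_Ioo.2 ⟨by omega, by omega⟩
  have hlocal := hiso.half_jump_sq_mul_depth_le_sum_sub_sq (hr.trans' (by simp only; omega)) (g η)
  rw [hdepth, Finset.sum_congr rfl fun t ht => by rw [← hconst t ht]] at hlocal
  have hsub : Finset.Ioc (η - k) (η + k) ⊆ Finset.Ioc 0 T :=
    Finset.Ioc_subset_Ioc (Nat.zero_le _) (by omega)
  linarith [Finset.sum_le_sum_of_subset_of_nonneg hsub fun t _ _ => sq_nonneg (f t - g t)]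

theorem Spaced.exists_nearChangePoint (hd : Spaced T f d) (hη : η ∈ changePoints T f)
    (hg : IsPiecewiseConst T S g)
    (hgd : 2 * ∑ t ∈ Finset.Ioc 0 T, (f t - g t) ^ 2 < jump f η ^ 2 * d) :
    ∃ s ∈ S, NearChangePoint f (2 * ∑ t ∈ Finset.Ioc 0 T, (f t - g t) ^ 2) s η := by
  set R := 2 * ∑ t ∈ Finset.Ioc 0 T, (f t - g t) ^ 2
  have hR : 0 ≤ R := by positivity
  have hJ : 0 < jump f η ^ 2 := pos_of_mul_pos_left (hR.trans_lt hgd) (Nat.cast_nonneg d)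
  have hfloor : R < jump f η ^ 2 * (⌊R / jump f η ^ 2⌋₊ + 1 : ℕ) := by
    rw [mul_comm, ← div_lt_iff₀ hJ, Nat.cast_add_one]
    exact Nat.lt_floor_add_one _
  have hk : ⌊R / jump f η ^ 2⌋₊ + 1 ≤ d :=
    (Nat.floor_lt (by positivity)).2 ((div_lt_iff₀' hJ).2 hgd)
  by_contra! hfar
  refine hfloor.not_ge (hd.jump_sq_mul_le_sum_sub_sq hη hg hk fun s hs hmem => hfar s hs ?_)
  obtain ⟨hl, hr⟩ := Finset.mem_Ioo.1 hmem
  have hdist : |(s : ℝ) - η| ≤ ⌊R / jump f η ^ 2⌋₊ := by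
    have : (s : ℝ) ≤ η + ⌊R / jump f η ^ 2⌋₊ := by exact_mod_cast (by omega)
    have : (η : ℝ) ≤ s + ⌊R / jump f η ^ 2⌋₊ := by exact_mod_cast (by omega)
    exact abs_sub_le_iff.2 ⟨by linarith, by linarith⟩
  exact (le_div_iff₀' hJ).1 (hdist.trans (Nat.floor_le (by positivity)))

theorem sum_mul_stepAt_sub_stepAt {a b : ℕ} (hab : a ≤ b) (hb : b ≤ T) (c : ℝ) (G : ℕ → ℝ) :
    ∑ t ∈ Finset.Ioc 0 T, G t * (stepAt a c t - stepAt b c t) =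
      c * ∑ t ∈ Finset.Ioc a b, G t := by
  rw [Finset.mul_sum, ← Finset.sum_subset (Finset.Ioc_subset_Ioc (Nat.zero_le a) hb)]
  · refine Finset.sum_congr rfl fun t ht => ?_
    obtain ⟨hat, htb⟩ := Finset.mem_Ioc.1 ht
    rw [stepAt, stepAt, if_pos hat, if_neg htb.not_gt, sub_zero, mul_comm]
  · intro t _ ht
    have hiff : a < t ↔ b < t := by
      rw [Finset.mem_Ioc] at ht
      omega
    rw [stepAt, stepAt, if_congr hiff rfl rfl, sub_self, mul_zero]

theorem sum_stepAt_sub_stepAt_sq {a b : ℕ} (ha : a ≤ T) (hb : b ≤ T) (c : ℝ) :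
    ∑ t ∈ Finset.Ioc 0 T, (stepAt a c t - stepAt b c t) ^ 2 = c ^ 2 * |(b : ℝ) - a| := by
  wlog hab : a ≤ b generalizing a b
  · rw [abs_sub_comm, ← this hb ha (le_of_not_ge hab)]
    exact Finset.sum_congr rfl fun t _ => sub_sq_comm _ _
  have hsq : ∀ t, (stepAt a c t - stepAt b c t) ^ 2 = c * (stepAt a c t - stepAt b c t) := by
    intro t
    simp only [stepAt]
    split_ifs
    · ring
    · ring
    · omega
    · ring
  rw [Finset.sum_congr rfl fun t _ => hsq t, sum_mul_stepAt_sub_stepAt hab hb,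
    sum_Ioc_const hab, abs_of_nonneg (sub_nonneg.2 (Nat.cast_le.2 hab))]
  ring

theorem NoiseControlled.sum_mul_stepAt_sub_stepAt_sq_le (hx : NoiseControlled T f x w) {a b : ℕ}
    (ha : a ≤ T) (hb : b ≤ T) (c : ℝ) :
    (∑ t ∈ Finset.Ioc 0 T, (x t - f t) * (stepAt a c t - stepAt b c t)) ^ 2 ≤
      w * (c ^ 2 * |(b : ℝ) - a|) := by
  wlog hab : a ≤ b generalizing a b
  · rw [abs_sub_comm, ← neg_sq, ← Finset.sum_neg_distrib]
    simpa only [← mul_neg, neg_sub] using this hb ha (le_of_not_ge hab)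
  rw [sum_mul_stepAt_sub_stepAt hab hb, mul_pow,
    abs_of_nonneg (sub_nonneg.2 (Nat.cast_le.2 hab)), mul_left_comm]
  exact mul_le_mul_of_nonneg_left (hx a b hab hb) (sq_nonneg c)

theorem sum_add_sum_sq_le {ι κ : Type*} (A : Finset ι) (K : Finset κ) (e : κ → ℝ) (u : ι → κ → ℝ)
    {a b : ℝ} (ha : ∀ i ∈ A, 2 * ∑ k ∈ K, e k * u i k ≤ a) (hb : ∀ i ∈ A, ∑ k ∈ K, u i k ^ 2 ≤ b) :
    ∑ k ∈ K, (e k + ∑ i ∈ A, u i k) ^ 2 ≤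
      ∑ k ∈ K, e k ^ 2 + A.card * a + (A.card : ℝ) ^ 2 * b := by
  have hcross : ∑ i ∈ A, 2 * ∑ k ∈ K, e k * u i k ≤ A.card * a := by
    simpa only [nsmul_eq_mul] using Finset.sum_le_card_nsmul _ _ _ ha
  have hsquare : ∑ i ∈ A, ∑ k ∈ K, u i k ^ 2 ≤ A.card * b := by
    simpa only [nsmul_eq_mul] using Finset.sum_le_card_nsmul _ _ _ hb
  calc ∑ k ∈ K, (e k + ∑ i ∈ A, u i k) ^ 2
      ≤ ∑ k ∈ K, (e k ^ 2 + ∑ i ∈ A, 2 * (e k * u i k) + A.card * ∑ i ∈ A, u i k ^ 2) := by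
        refine Finset.sum_le_sum fun k _ => ?_
        have := sq_sum_le_card_mul_sum_sq (s := A) (f := fun i => u i k)
        rw [← Finset.mul_sum, ← Finset.mul_sum]
        linarith
    _ = ∑ k ∈ K, e k ^ 2 + ∑ i ∈ A, 2 * ∑ k ∈ K, e k * u i k +
          A.card * ∑ i ∈ A, ∑ k ∈ K, u i k ^ 2 := by
        simp only [Finset.sum_add_distrib, Finset.mul_sum]
        rw [Finset.sum_comm, Finset.sum_comm (s := K)]
    _ ≤ ∑ k ∈ K, e k ^ 2 + A.card * a + (A.card : ℝ) ^ 2 * b := by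
        rw [sq (A.card : ℝ), mul_assoc]
        gcongr

theorem isPiecewiseConst_add_sum_stepAt {ι : Type*} (A : Finset ι) {e : ι → ℕ}
    (he : ∀ i ∈ A, e i ∈ S) (b : ℝ) (c : ι → ℝ) :
    IsPiecewiseConst T S fun t => b + ∑ i ∈ A, stepAt (e i) (c i) t := by
  intro t t' _ htt' _ hno
  simp only [add_right_inj]
  refine Finset.sum_congr rfl fun i hi => ?_
  have hiff : e i < t ↔ e i < t' := by
    have := hno _ (he i hi)
    rw [Finset.mem_Ico] at this
    omega
  rw [stepAt, stepAt, if_congr hiff rfl rfl]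

/-- The competitor is the signal with each jump moved to its estimate. -/
theorem NoiseControlled.rss_le (hx : NoiseControlled T f x w) (hw : 0 ≤ w) (hB : 0 ≤ B)
    (hS : S ⊆ Finset.Ioo 0 T)
    (hnear : ∀ η ∈ changePoints T f, ∃ s ∈ S, NearChangePoint f B s η) :
    rss T x S ≤ ∑ t ∈ Finset.Ioc 0 T, (x t - f t) ^ 2 + (changePoints T f).card * (w + B) +
      ((changePoints T f).card : ℝ) ^ 2 * B := by
  choose! e heS he using hnear
  set c : ℕ → ℝ := fun η => f (η + 1) - f η
  have hle : ∀ η ∈ changePoints T f, η ≤ T ∧ e η ≤ T := fun η hη =>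
    ⟨(Finset.mem_Ioo.1 (changePoints_subset T f hη)).2.le, (Finset.mem_Ioo.1 (hS (heS η hη))).2.le⟩
  have hmove : ∀ η ∈ changePoints T f, c η ^ 2 * |(e η : ℝ) - η| ≤ B := by
    simpa only [NearChangePoint, jump_sq] using he
  refine (rss_le_sum_sub_sq x hS (isPiecewiseConst_add_sum_stepAt _ heS (f 1) c)).trans ?_
  have hfit : ∀ t ∈ Finset.Ioc 0 T,
      x t - (f 1 + ∑ η ∈ changePoints T f, stepAt (e η) (c η) t) =
        x t - f t + ∑ η ∈ changePoints T f, (stepAt η (c η) t - stepAt (e η) (c η) t) := by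
    intro t ht
    rw [Finset.sum_sub_distrib]
    linarith [signal_eq_add_sum_stepAt (f := f) ht]
  rw [Finset.sum_congr rfl fun t ht => by rw [hfit t ht]]
  refine sum_add_sum_sq_le _ _ _ _ (fun η hη => ?_) fun η hη => ?_
  · have hcross := hx.sum_mul_stepAt_sub_stepAt_sq_le (hle η hη).1 (hle η hη).2 (c η)
    have hbound := mul_le_mul_of_nonneg_left (hmove η hη) hw
    exact (abs_le_of_sq_le_sq' (by linarith [sq_nonneg (w - B)]) (by positivity)).2
  · exact (sum_stepAt_sub_stepAt_sq (hle η hη).1 (hle η hη).2 (c η)).trans_le (hmove η hη)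

end Comparison

/-! ### The information criterion -/

section Criterion

variable {T d : ℕ} {f x : ℕ → ℝ} {w B γ θ : ℝ} {S S' : Finset ℕ}

/-- `S` has as many elements as there are change points, and in increasing order the elements of
`S` are within `B / δ ^ 2` of the change points. -/
def IsLocalized (T : ℕ) (f : ℕ → ℝ) (S : Finset ℕ) (B : ℝ) : Prop :=
  ∃ hN : S.card = (changePoints T f).card, ∀ i : Fin (changePoints T f).card,
    jump f ((changePoints T f).orderEmbOfFin rfl i) ^ 2 *
      |(S.orderEmbOfFin hN i : ℝ) - ((changePoints T f).orderEmbOfFin rfl i : ℝ)| ≤ B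

theorem IsLocalized.mono {B' : ℝ} (h : IsLocalized T f S B) (hB : B ≤ B') :
    IsLocalized T f S B' :=
  ⟨h.1, fun i => (h.2 i).trans hB⟩

theorem Spaced.card_changePoints_le (hd : Spaced T f d)
    (hB : ∀ η ∈ changePoints T f, 2 * B < jump f η ^ 2 * d)
    (hnear : ∀ η ∈ changePoints T f, ∃ s ∈ S, NearChangePoint f B s η) :
    (changePoints T f).card ≤ S.card := by
  choose! e heS he using hnear
  refine Finset.card_le_card_of_injOn e heS fun η hη η' hη' heq => ?_
  have hclose := (he η hη).two_mul_lt (hB η hη)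
  have hclose' := (he η' hη').two_mul_lt (hB η' hη')
  rcases lt_trichotomy η η' with h | h | h
  · have := hd.le_sub η hη η' hη' h
    omega
  · exact h
  · have := hd.le_sub η' hη' η hη h
    omega

theorem Spaced.isLocalized (hd : Spaced T f d)
    (hB : ∀ η ∈ changePoints T f, 2 * B < jump f η ^ 2 * d)
    (hcard : S.card = (changePoints T f).card)
    (hnear : ∀ η ∈ changePoints T f, ∃ s ∈ S, NearChangePoint f B s η) :
    IsLocalized T f S B := by
  choose! e heS he using hnear
  set cp := (changePoints T f).orderEmbOfFin rfl
  have hmem : ∀ i, cp i ∈ changePoints T f := (changePoints T f).orderEmbOfFin_mem rfl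
  have hmono : StrictMono fun i => e (cp i) := by
    intro i j hij
    have := hd.le_sub _ (hmem i) _ (hmem j) (cp.strictMono hij)
    have := (he _ (hmem i)).two_mul_lt (hB _ (hmem i))
    have := (he _ (hmem j)).two_mul_lt (hB _ (hmem j))
    simp only
    omega
  refine ⟨hcard, fun i => ?_⟩
  rw [← congrFun (Finset.orderEmbOfFin_unique hcard (fun i => heS _ (hmem i)) hmono) i]
  exact he _ (hmem i)

theorem NoiseControlled.sum_sub_segmentMeanFit_sq_add_le (hx : NoiseControlled T f x w)
    (hw : 0 ≤ w) (hS : S ⊆ Finset.Ioo 0 T) (hS' : S' ⊆ Finset.Ioo 0 T)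
    (hcard : S'.card ≤ (changePoints T f).card)
    (hnear : ∀ η ∈ changePoints T f, ∃ s ∈ S', NearChangePoint f (36 * w) s η)
    (hpen : 0 ≤ γ * Real.log T ^ θ) (hle : sSIC γ θ T x S ≤ sSIC γ θ T x S') :
    (∑ t ∈ Finset.Ioc 0 T, (f t - segmentMeanFit T x S t) ^ 2) / 2 +
        S.card * (γ * Real.log T ^ θ) ≤
      41 * ((changePoints T f).card + 1) ^ 2 * w +
        (changePoints T f).card * (γ * Real.log T ^ θ) +
        2 * w * (S.card - (changePoints T f).card) := by
  have hlower := hx.le_sum_sub_sq_of_isPiecewiseConst hw hS (isPiecewiseConst_segmentMeanFit x hS)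
  rw [← rss_eq_sum_sub_segmentMeanFit_sq x hS] at hlower
  have hupper := hx.rss_le hw (by positivity) hS' hnear
  have hcard' : S'.card * (γ * Real.log T ^ θ) ≤
      (changePoints T f).card * (γ * Real.log T ^ θ) := by gcongr
  rw [sSIC, sSIC] at hle
  nlinarith [mul_nonneg (Nat.cast_nonneg (α := ℝ) (changePoints T f).card) hw,
    mul_nonneg (sq_nonneg ((changePoints T f).card : ℝ)) hw]

theorem NoiseControlled.isLocalized_of_sSIC_le (hx : NoiseControlled T f x w) (hw : 0 < w)
    (hd : Spaced T f d) (hS : S ⊆ Finset.Ioo 0 T) (hS' : S' ⊆ Finset.Ioo 0 T)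
    (hcard : S'.card ≤ (changePoints T f).card)
    (hnear : ∀ η ∈ changePoints T f, ∃ s ∈ S', NearChangePoint f (36 * w) s η)
    (hpen : 48 * ((changePoints T f).card + 1) ^ 2 * w ≤ γ * Real.log T ^ θ)
    (hdpen : ∀ η ∈ changePoints T f,
      8 * ((changePoints T f).card + 1) * (γ * Real.log T ^ θ) < jump f η ^ 2 * d)
    (hle : sSIC γ θ T x S ≤ sSIC γ θ T x S') :
    IsLocalized T f S (164 * ((changePoints T f).card + 1) ^ 2 * w) := by
  have hpen_nonneg : 0 ≤ γ * Real.log T ^ θ := le_trans (by positivity) hpen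
  have hmain := hx.sum_sub_segmentMeanFit_sq_add_le hw.le hS hS' hcard hnear hpen_nonneg hle
  set Q := ∑ t ∈ Finset.Ioc 0 T, (f t - segmentMeanFit T x S t) ^ 2
  have hQ_nonneg : 0 ≤ Q := by positivity
  set pen := γ * Real.log T ^ θ
  have hN : (1 : ℝ) ≤ ((changePoints T f).card + 1) ^ 2 := by
    rw [← Nat.cast_add_one]
    exact one_le_pow₀ (Nat.one_le_cast.2 (Nat.succ_pos _))
  have hwN := mul_le_mul_of_nonneg_right hN hw.le
  have hupper : S.card ≤ (changePoints T f).card := by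
    by_contra! hlt
    have hexcess : (1 : ℝ) ≤ S.card - (changePoints T f).card := by
      rw [le_sub_iff_add_le']
      exact_mod_cast hlt
    nlinarith [mul_le_mul_of_nonneg_right hexcess (show 0 ≤ pen - 2 * w by linarith)]
  have hexcess : (S.card : ℝ) - (changePoints T f).card ≤ 0 :=
    sub_nonpos.2 (Nat.cast_le.2 hupper)
  have hQ_le : Q ≤ 2 * ((changePoints T f).card + 1) * pen := by
    nlinarith [mul_nonneg (Nat.cast_nonneg (α := ℝ) S.card) hpen_nonneg]
  have hB : ∀ η ∈ changePoints T f, 2 * (2 * Q) < jump f η ^ 2 * d := fun η hη => by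
    linarith [hdpen η hη]
  have hfound : ∀ η ∈ changePoints T f, ∃ s ∈ S, NearChangePoint f (2 * Q) s η := fun η hη =>
    hd.exists_nearChangePoint hη (isPiecewiseConst_segmentMeanFit x hS) (by linarith [hB η hη])
  have hcard_eq : S.card = (changePoints T f).card :=
    hupper.antisymm (hd.card_changePoints_le hB hfound)
  rw [hcard_eq, sub_self] at hmain
  exact (hd.isLocalized hB hcard_eq hfound).mono (by linarith)

end Criterion

/-! ### Seeded intervals -/

section SeededIntervals

variable {a : ℝ} {m T d k η : ℕ}

theorem layerLength_le (ha₀ : 0 ≤ a) (ha₁ : a ≤ 1) (T k : ℕ) : layerLength a T k ≤ T :=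
  mul_le_of_le_one_right (Nat.cast_nonneg T) (pow_le_one₀ ha₀ ha₁)

theorem layerLength_mul_one_div_pow (ha : a ≠ 0) (T k : ℕ) :
    layerLength a T k * (1 / a) ^ (k - 1) = T := by
  rw [layerLength, mul_assoc, ← mul_pow, mul_one_div_cancel ha, one_pow, mul_one]

theorem layerShift_mul (h : 1 < layerCount a k) :
    layerShift a T k * ((layerCount a k : ℝ) - 1) = T - layerLength a T k :=
  div_mul_cancel₀ _ (sub_pos.2 (Nat.one_lt_cast.2 h)).ne'

theorem snd_le_of_mem_layer (ha₀ : 0 ≤ a) (ha₁ : a ≤ 1) {I : ℕ × ℕ} (hI : I ∈ layer a T k) :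
    I.2 ≤ T := by
  obtain ⟨i, hi, rfl⟩ := Finset.mem_image.1 hI
  obtain ⟨hi1, hin⟩ := Finset.mem_Icc.1 hi
  have hl := layerLength_le ha₀ ha₁ T k
  refine Nat.ceil_le.2 (le_sub_iff_add_le.1 ?_)
  rcases hi1.eq_or_lt with rfl | h
  · rw [Nat.cast_one, sub_self, zero_mul]
    exact sub_nonneg.2 hl
  · have hcount : (1 : ℝ) < layerCount a k := Nat.one_lt_cast.2 (h.trans_le hin)
    have hshift : 0 ≤ layerShift a T k := div_nonneg (sub_nonneg.2 hl) (sub_pos.2 hcount).le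
    calc ((i : ℝ) - 1) * layerShift a T k ≤ ((layerCount a k : ℝ) - 1) * layerShift a T k := by
          gcongr
      _ = T - layerLength a T k := by rw [mul_comm, layerShift_mul (h.trans_le hin)]

theorem snd_le_of_mem_seededIntervals (ha₀ : 0 ≤ a) (ha₁ : a ≤ 1) {I : ℕ × ℕ}
    (hI : I ∈ seededIntervals a m T) : I.2 ≤ T := by
  obtain ⟨hI, -⟩ := Finset.mem_filter.1 hI
  obtain ⟨k, -, hI⟩ := Finset.mem_biUnion.1 hI
  exact snd_le_of_mem_layer ha₀ ha₁ hI

theorem exists_layerLength_mem_Ico (ha₀ : 0 < a) (ha₁ : a < 1) {b : ℝ} (hb : 1 < a * b)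
    (hbT : b ≤ T) :
    ∃ k ∈ Finset.Icc 1 ⌈Real.logb (1 / a) T⌉₊, layerLength a T k ∈ Set.Ico (a * b) b := by
  have hb₀ : 0 < b := pos_of_mul_pos_right (zero_lt_one.trans hb) ha₀.le
  have hT : (0 : ℝ) < T := hb₀.trans_le hbT
  obtain ⟨n, hn, hn'⟩ := exists_nat_pow_near_of_lt_one (div_pos hb₀ hT)
    ((div_le_one hT).2 hbT) ha₀ ha₁
  have hlower : a * b ≤ layerLength a T (n + 2) := by
    rw [div_le_iff₀' hT] at hn'
    calc a * b ≤ a * (T * a ^ n) := by gcongr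
      _ = T * a ^ (n + 1) := by ring
  have hlast : n + 1 < ⌈Real.logb (1 / a) T⌉₊ := by
    rw [Nat.lt_ceil, Real.lt_logb_iff_rpow_lt (one_lt_one_div ha₀ ha₁) hT, Real.rpow_natCast]
    calc (1 / a) ^ (n + 1) < layerLength a T (n + 2) * (1 / a) ^ (n + 1) :=
          lt_mul_of_one_lt_left (by positivity) (hb.trans_le hlower)
      _ = T := layerLength_mul_one_div_pow ha₀.ne' T (n + 2)
  exact ⟨n + 2, Finset.mem_Icc.2 ⟨by omega, hlast⟩, hlower, (lt_div_iff₀' hT).1 hn⟩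

theorem cast_layerCount_sub_one (ha : 0 < a) :
    (layerCount a k : ℝ) - 1 = 2 * (⌈(1 / a) ^ (k - 1)⌉₊ - 1) := by
  have hceil : 1 ≤ ⌈(1 / a) ^ (k - 1)⌉₊ := Nat.one_le_ceil_iff.2 (by positivity)
  rw [layerCount, Nat.cast_sub (by omega)]
  push_cast
  ring

theorem one_lt_layerCount (ha : 0 < a) (hl : layerLength a T k < T) : 1 < layerCount a k := by
  have hpow : 1 < (1 / a) ^ (k - 1) := by
    rw [← layerLength_mul_one_div_pow ha.ne' T k] at hl
    refine lt_of_mul_lt_mul_left (a := layerLength a T k) ?_ ?_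
    · rwa [mul_one]
    · exact mul_nonneg (Nat.cast_nonneg T) (by positivity)
  have hceil : (1 : ℝ) < ⌈(1 / a) ^ (k - 1)⌉₊ := hpow.trans_le (Nat.le_ceil _)
  exact_mod_cast (by linarith [cast_layerCount_sub_one (k := k) ha] : (1 : ℝ) < layerCount a k)

theorem layerShift_pos (ha : 0 < a) (hl : layerLength a T k < T) : 0 < layerShift a T k :=
  div_pos (sub_pos.2 hl) (sub_pos.2 (Nat.one_lt_cast.2 (one_lt_layerCount ha hl)))

theorem layerShift_le (ha : 0 < a) (hl : layerLength a T k < T) :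
    layerShift a T k ≤ layerLength a T k / 2 := by
  have hcount := one_lt_layerCount ha hl
  have hlen : 0 ≤ layerLength a T k := mul_nonneg (Nat.cast_nonneg T) (by positivity)
  rw [layerShift, div_le_iff₀ (sub_pos.2 (Nat.one_lt_cast.2 hcount)), cast_layerCount_sub_one ha]
  linarith [mul_le_mul_of_nonneg_left (Nat.le_ceil ((1 / a) ^ (k - 1))) hlen,
    layerLength_mul_one_div_pow ha.ne' T k]

/-- The left end is the largest multiple of the shift that is at least a quarter of the length below
`η`; since the shift is at most half of the length, the right end is far enough above `η`. -/
theorem exists_mem_layer (ha : 0 < a) (hl : layerLength a T k < T)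
    (hleft : layerLength a T k / 4 ≤ η) (hright : η + 3 * layerLength a T k / 4 ≤ T) :
    ∃ I ∈ layer a T k, (I.1 : ℝ) + layerLength a T k / 4 ≤ η ∧
      (η : ℝ) + layerLength a T k / 4 ≤ I.2 ∧ (I.1 : ℝ) + layerLength a T k ≤ I.2 ∧
      (I.2 : ℝ) ≤ I.1 + layerLength a T k + 2 := by
  have hs := layerShift_pos ha hl
  have hsl := layerShift_le ha hl
  have hcount := layerShift_mul (T := T) (one_lt_layerCount ha hl)
  set l := layerLength a T k
  set s := layerShift a T k
  have hl₀ : 0 < l := by linarith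
  set j := ⌊(η - l / 4) / s⌋₊
  have hj : j * s ≤ η - l / 4 :=
    (le_div_iff₀ hs).1 (Nat.floor_le (div_nonneg (sub_nonneg.2 hleft) hs.le))
  have hj' : η - l / 4 < (j + 1) * s := (div_lt_iff₀ hs).1 (Nat.lt_floor_add_one _)
  have hjcount : j + 1 ≤ layerCount a k := by
    have : (j : ℝ) ≤ (layerCount a k : ℝ) - 1 := le_of_mul_le_mul_right (by linarith) hs
    exact_mod_cast le_sub_iff_add_le.1 this
  have hI : (⌊(j : ℝ) * s⌋₊, ⌈(j : ℝ) * s + l⌉₊) ∈ layer a T k :=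
    Finset.mem_image.2 ⟨j + 1, Finset.mem_Icc.2 ⟨Nat.le_add_left 1 j, hjcount⟩, by
      rw [Nat.cast_add_one, add_sub_cancel_right]⟩
  have hfloor : ((⌊(j : ℝ) * s⌋₊ : ℕ) : ℝ) ≤ j * s := Nat.floor_le (by positivity)
  have hfloor' := Nat.lt_floor_add_one ((j : ℝ) * s)
  have hceil := Nat.le_ceil ((j : ℝ) * s + l)
  have hceil' := Nat.ceil_lt_add_one (show 0 ≤ (j : ℝ) * s + l by positivity)
  exact ⟨_, hI, by linarith, by linarith, by linarith, by linarith⟩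

theorem exists_mem_seededIntervals (ha₀ : 0 < a) (ha₁ : a < 1) (had : 8 ≤ a * d)
    (hmd : 4 * m ≤ a * d) (hl : d ≤ η) (hr : η + d ≤ T) :
    ∃ I ∈ seededIntervals a m T, a * d / 16 ≤ depth I η ∧ 2 * (I.2 - I.1) ≤ d := by
  have hd : (8 : ℝ) ≤ d := had.trans (mul_le_of_le_one_left (Nat.cast_nonneg d) ha₁.le)
  have hlR : (d : ℝ) ≤ η := Nat.cast_le.2 hl
  have hrR : (η : ℝ) + d ≤ T := by exact_mod_cast hr
  obtain ⟨k, hk, hlen, hlen'⟩ := exists_layerLength_mem_Ico (T := T) (b := d / 4) ha₀ ha₁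
    (by linarith) (by linarith)
  obtain ⟨I, hI, hIl, hIr, hmin, hmax⟩ := exists_mem_layer (η := η) ha₀ (by linarith) (by linarith)
    (by linarith)
  have hηl : I.1 ≤ η := by exact_mod_cast (by linarith : (I.1 : ℝ) ≤ η)
  have hηr : η ≤ I.2 := by exact_mod_cast (by linarith : (η : ℝ) ≤ I.2)
  have hsub : ((I.2 - I.1 : ℕ) : ℝ) = I.2 - I.1 := Nat.cast_sub (hηl.trans hηr)
  refine ⟨I, Finset.mem_filter.2 ⟨Finset.mem_biUnion.2 ⟨k, hk, hI⟩, ?_⟩, ?_, ?_⟩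
  · exact_mod_cast (by linarith : (m : ℝ) ≤ (I.2 - I.1 : ℕ))
  · rw [depth, Nat.cast_min, Nat.cast_sub hηl, Nat.cast_sub hηr]
    exact le_min (by linarith) (by linarith)
  · exact_mod_cast (by linarith : 2 * ((I.2 - I.1 : ℕ) : ℝ) ≤ d)

end SeededIntervals

/-! ### Consistency for controlled noise -/

theorem IsSeedBSEstimate.isLocalized {a : ℝ} (ha₀ : 0 < a) (ha₁ : a < 1) {m T d : ℕ} {γ θ w : ℝ}
    {f x : ℕ → ℝ} {S : Finset ℕ} (hS : IsSeedBSEstimate a m γ θ T x S)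
    (hx : NoiseControlled T f x w) (hw : 0 < w) (hd : Spaced T f d) (had : 8 ≤ a * d)
    (hmd : 4 * m ≤ a * d)
    (hpen : 48 * ((changePoints T f).card + 1) ^ 2 * w ≤ γ * Real.log T ^ θ)
    (hdpen : ∀ η ∈ changePoints T f,
      24 * ((changePoints T f).card + 1) * (γ * Real.log T ^ θ) < a * (jump f η ^ 2 * d)) :
    IsLocalized T f S (164 * ((changePoints T f).card + 1) ^ 2 * w) := by
  obtain ⟨path, hpath, κ₀, hκ₀, rfl, hmin⟩ := hS
  have hJ : ∀ I ∈ seededIntervals a m T, I.2 ≤ T := fun I hI =>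
    snd_le_of_mem_seededIntervals ha₀.le ha₁.le hI
  set N : ℝ := ((changePoints T f).card : ℝ)
  have hN : 0 ≤ N := Nat.cast_nonneg _
  have hwpen : 72 * w ≤ 24 * (N + 1) * (γ * Real.log T ^ θ) := by
    nlinarith [mul_nonneg hN hw.le, mul_nonneg (sq_nonneg N) hw.le]
  have hjump : ∀ η ∈ changePoints T f,
      24 * (N + 1) * (γ * Real.log T ^ θ) < jump f η ^ 2 * d := fun η hη =>
    (hdpen η hη).trans_le (mul_le_of_le_one_left (by positivity) ha₁.le)
  choose! good hgood hdeep hlen using fun η (hη : η ∈ changePoints T f) =>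
    exists_mem_seededIntervals ha₀ ha₁ had hmd (hd.le_left η hη) (hd.le_right η hη)
  have hmem : ∀ η ∈ changePoints T f, η ∈ Finset.Ioo (good η).1 (good η).2 := fun η hη =>
    Finset.mem_Ioo.2 (depth_pos.1 (by exact_mod_cast (by linarith [hdeep η hη] :
      (0 : ℝ) < depth (good η) η)))
  have hover : ∀ η ∈ changePoints T f,
      OverThreshold x (threshold (changePoints T f).card w) (good η) := by
    intro η hη
    have hiso : Isolates T f (good η) η := by
      have := Finset.mem_Ioo.1 (hmem η hη)
      have := hlen η hη
      exact hd.isolates hη (by omega) (by omega)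
    refine hx.overThreshold hw.le (hJ _ (hgood η hη)) hiso ?_
    nlinarith [hdpen η hη, mul_le_mul_of_nonneg_left (hdeep η hη) (sq_nonneg (jump f η))]
  have hκ : 0 ≤ threshold (changePoints T f).card w := by
    rw [threshold]
    positivity
  obtain ⟨hcard, hnear⟩ := (hpath _ hκ).card_add_card_le (D := ∅) hx hw.le hd
    (fun η hη => hwpen.trans_lt (hjump η hη)) hmem hlen hover
    ⟨hJ, Finset.empty_subset _, fun η hη _ => hgood η hη, by simp⟩
  exact hx.isLocalized_of_sSIC_le hw hd ((hpath _ hκ₀).subset hJ) ((hpath _ hκ).subset hJ) hcard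
    (fun η hη => hnear η hη (Finset.notMem_empty η)) hpen
    (fun η hη => by nlinarith [hjump η hη]) (hmin _ hκ)

/-! ### Gaussian noise -/

section Noise

variable {Ω : Type*} [MeasurableSpace Ω] {P : Measure Ω}

theorem hasSubgaussianMGF_of_hasLaw_gaussianReal {Y : Ω → ℝ} {v : NNReal}
    (h : HasLaw Y (gaussianReal 0 v) P) : HasSubgaussianMGF Y v P := by
  rw [← HasSubgaussianMGF.id_map_iff h.aemeasurable, h.map_eq]
  refine ⟨integrable_exp_mul_gaussianReal, fun t => ?_⟩
  simp only [mgf_id_gaussianReal, zero_mul, zero_add, le_refl]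

theorem measureReal_lt_sq_le [IsFiniteMeasure P] {Y : Ω → ℝ} {c : NNReal}
    (hY : HasSubgaussianMGF Y c P) {b : ℝ} (hb : 0 ≤ b) :
    P.real {ω | b < Y ω ^ 2} ≤ 2 * Real.exp (-b / (2 * c)) := by
  have hup := hY.measure_ge_le (Real.sqrt_nonneg b)
  have hdown := hY.neg.measure_ge_le (Real.sqrt_nonneg b)
  rw [Real.sq_sqrt hb] at hup hdown
  calc P.real {ω | b < Y ω ^ 2} ≤ P.real ({ω | √b ≤ Y ω} ∪ {ω | √b ≤ (-Y) ω}) :=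
        measureReal_mono fun ω hω =>
          le_abs.1 ((Real.sqrt_le_sqrt (le_of_lt hω)).trans_eq (Real.sqrt_sq_eq_abs _))
    _ ≤ 2 * Real.exp (-b / (2 * c)) := by
        rw [two_mul]
        exact (measureReal_union_le _ _).trans (add_le_add hup hdown)

namespace IsGaussianModel

variable {T : ℕ} {f : ℕ → ℝ} {X : ℕ → Ω → ℝ}

theorem hasSubgaussianMGF_sum (h : IsGaussianModel P T f X) (u : ℕ) {v : ℕ}
    (hv : v ≤ T) :
    HasSubgaussianMGF (fun ω => ∑ t ∈ Finset.Ioc u v, (X t ω - f t)) ((v - u : ℕ) : NNReal) P := by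
  have hmem : ∀ t ∈ Finset.Ioc u v, t ∈ Finset.Icc 1 T := by
    intro t ht
    rw [Finset.mem_Ioc] at ht
    exact Finset.mem_Icc.2 ⟨by omega, by omega⟩
  convert HasSubgaussianMGF.sum_of_iIndepFun (c := fun _ => 1)
    (s := (Finset.Ioc u v).subtype (· ∈ Finset.Icc 1 T)) h.indep
    fun t _ => hasSubgaussianMGF_of_hasLaw_gaussianReal (h.law t t.2) using 1
  · exact funext fun ω => (Finset.sum_subtype_of_mem (fun t => X t ω - f t) hmem).symm
  · rw [Finset.sum_subtype_of_mem (fun _ => (1 : NNReal)) hmem, Finset.sum_const, Nat.card_Ioc,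
      nsmul_one]

theorem measureReal_lt_sum_sq_le [IsProbabilityMeasure P] (h : IsGaussianModel P T f X) {w : ℝ}
    (hw : 0 ≤ w) {u v : ℕ} (huv : u ≤ v) (hv : v ≤ T) :
    P.real {ω | w * ((v : ℝ) - u) < (∑ t ∈ Finset.Ioc u v, (X t ω - f t)) ^ 2} ≤
      2 * Real.exp (-w / 2) := by
  rcases huv.eq_or_lt with rfl | hlt
  · simp only [sub_self, mul_zero, Finset.Ioc_self, Finset.sum_empty, ne_eq, OfNat.ofNat_ne_zero,
      not_false_eq_true, zero_pow, lt_irrefl, Set.ofPred_false, measureReal_empty]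
    positivity
  · have hn : (0 : ℝ) < (v : ℝ) - u := sub_pos.2 (Nat.cast_lt.2 hlt)
    convert measureReal_lt_sq_le (h.hasSubgaussianMGF_sum u hv) (mul_nonneg hw hn.le) using 3
    rw [NNReal.coe_natCast, Nat.cast_sub huv]
    field_simp

theorem measureReal_not_noiseControlled_le [IsProbabilityMeasure P] (h : IsGaussianModel P T f X)
    {w : ℝ} (hw : 0 ≤ w) :
    P.real {ω | ¬NoiseControlled T f (fun t => X t ω) w} ≤
      ((T : ℝ) + 1) ^ 2 * (2 * Real.exp (-w / 2)) := by
  let A : Finset (ℕ × ℕ) :=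
    (Finset.range (T + 1) ×ˢ Finset.range (T + 1)).filter fun p => p.1 ≤ p.2
  have hcard : (A.card : ℝ) ≤ ((T : ℝ) + 1) ^ 2 := by
    have : A.card ≤ (T + 1) ^ 2 := (Finset.card_filter_le _ _).trans (by
      rw [Finset.card_product, Finset.card_range, sq])
    exact_mod_cast this
  have hsub : {ω | ¬NoiseControlled T f (fun t => X t ω) w} ⊆ ⋃ p ∈ A,
      {ω | w * ((p.2 : ℝ) - p.1) < (∑ t ∈ Finset.Ioc p.1 p.2, (X t ω - f t)) ^ 2} := by
    intro ω hω
    rw [Set.mem_ofPred_eq, NoiseControlled] at hω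
    push Not at hω
    obtain ⟨u, v, huv, hv, hlt⟩ := hω
    refine Set.mem_biUnion (x := (u, v)) (Finset.mem_coe.2 (Finset.mem_filter.2 ⟨?_, huv⟩)) hlt
    simp only [Finset.mem_product, Finset.mem_range]
    omega
  calc P.real {ω | ¬NoiseControlled T f (fun t => X t ω) w}
      ≤ ∑ p ∈ A, P.real {ω | w * ((p.2 : ℝ) - p.1) <
          (∑ t ∈ Finset.Ioc p.1 p.2, (X t ω - f t)) ^ 2} :=
        (measureReal_mono hsub (measure_ne_top _ _)).trans (measureReal_biUnion_finset_le _ _)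
    _ ≤ A.card • (2 * Real.exp (-w / 2)) := by
        refine Finset.sum_le_card_nsmul A _ _ fun p hp => ?_
        simp only [A, Finset.mem_filter, Finset.mem_product, Finset.mem_range] at hp
        exact h.measureReal_lt_sum_sq_le hw hp.2 (by omega)
    _ ≤ ((T : ℝ) + 1) ^ 2 * (2 * Real.exp (-w / 2)) := by
        rw [nsmul_eq_mul]
        gcongr

end IsGaussianModel

end Noise

theorem tendsto_sq_mul_exp_neg_log :
    Tendsto (fun T : ℕ => ((T : ℝ) + 1) ^ 2 * (2 * Real.exp (-(8 * Real.log T) / 2))) atTop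
      (𝓝 0) := by
  refine squeeze_zero' (g := fun T : ℕ => 8 / (T : ℝ))
    (Eventually.of_forall fun T => by positivity) ?_ (tendsto_const_div_atTop_nhds_zero_nat 8)
  filter_upwards [eventually_ge_atTop 1] with T hT
  have hT₁ : (1 : ℝ) ≤ T := Nat.one_le_cast.2 hT
  have hT₀ : (0 : ℝ) < T := zero_lt_one.trans_le hT₁
  have hexp : Real.exp (-(8 * Real.log T) / 2) = ((T : ℝ) ^ 4)⁻¹ := by
    rw [show -(8 * Real.log T) / 2 = -((4 : ℕ) * Real.log T) by push_cast; ring, Real.exp_neg,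
      Real.exp_nat_mul, Real.exp_log hT₀]
  calc ((T : ℝ) + 1) ^ 2 * (2 * Real.exp (-(8 * Real.log T) / 2))
      ≤ (2 * (T : ℝ)) ^ 2 * (2 * ((T : ℝ) ^ 4)⁻¹) := by
        rw [hexp]
        gcongr
        linarith
    _ = 8 / (T : ℝ) / T := by
        field_simp
        norm_num
    _ ≤ 8 / (T : ℝ) := div_le_self (by positivity) hT₁

theorem tendsto_measure_noiseControlled {Ω : ℕ → Type*} [∀ T, MeasurableSpace (Ω T)]
    {P : ∀ T, Measure (Ω T)} [∀ T, IsProbabilityMeasure (P T)] {f : ℕ → ℕ → ℝ}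
    {X : ∀ T, ℕ → Ω T → ℝ} (hX : ∀ T, IsGaussianModel (P T) T (f T) (X T)) :
    Tendsto (fun T : ℕ => P T {ω | NoiseControlled T (f T) (fun t => X T t ω) (8 * Real.log T)})
      atTop (𝓝 1) := by
  have hlower : Tendsto (fun T : ℕ => ENNReal.ofReal
      (1 - ((T : ℝ) + 1) ^ 2 * (2 * Real.exp (-(8 * Real.log T) / 2)))) atTop (𝓝 1) := by
    simpa only [sub_zero, ENNReal.ofReal_one] using
      ENNReal.tendsto_ofReal (tendsto_sq_mul_exp_neg_log.const_sub 1)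
  refine tendsto_of_tendsto_of_tendsto_of_le_of_le hlower tendsto_const_nhds (fun T => ?_)
    fun T => prob_le_one
  have hlog : 0 ≤ 8 * Real.log T := mul_nonneg (by norm_num) (Real.log_natCast_nonneg T)
  rw [ENNReal.ofReal_le_iff_le_toReal (measure_ne_top _ _), sub_le_iff_le_add]
  calc (1 : ℝ) = (P T).real ({ω | NoiseControlled T (f T) (fun t => X T t ω) (8 * Real.log T)} ∪
          {ω | NoiseControlled T (f T) (fun t => X T t ω) (8 * Real.log T)}ᶜ) := by
        rw [Set.union_compl_self, probReal_univ]
    _ ≤ _ := (measureReal_union_le _ _).trans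
        (add_le_add_right ((hX T).measureReal_not_noiseControlled_le hlog) _)

theorem eventually_mul_log_rpow_lt (A : ℝ) {B p q : ℝ} (hB : 0 < B) (hpq : p < q) :
    ∀ᶠ T : ℕ in atTop, A * Real.log T ^ p < B * Real.log T ^ q := by
  have hlog : Tendsto (fun T : ℕ => Real.log T) atTop atTop :=
    Real.tendsto_log_atTop.comp tendsto_natCast_atTop_atTop
  have hpow := (tendsto_rpow_atTop (sub_pos.2 hpq)).comp hlog
  filter_upwards [hpow.eventually_gt_atTop (A / B), hlog.eventually_gt_atTop 0] with T hdiv hpos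
  rw [Function.comp_apply, div_lt_iff₀' hB] at hdiv
  calc A * Real.log T ^ p < B * Real.log T ^ (q - p) * Real.log T ^ p := by gcongr
    _ = B * Real.log T ^ q := by rw [mul_assoc, ← Real.rpow_add hpos, sub_add_cancel]

theorem eventually_isLocalized {θ₀ θ γ K c a : ℝ} (m : ℕ) (hθ : 1 < θ) (hθθ₀ : θ < θ₀)
    (hγ : 0 < γ) (hc : 0 < c) (ha : a ∈ Set.Ioo (0 : ℝ) 1) {f : ℕ → ℕ → ℝ}
    (hf : ∀ᶠ T : ℕ in atTop,
      Real.log T ^ θ₀ ≤ (minSpacing T (changePoints T (f T)) : ℝ) ∧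
      ((changePoints T (f T)).card : ℝ) ≤ K ∧
      ∀ η ∈ changePoints T (f T), c ≤ jump (f T) η) :
    ∀ᶠ T : ℕ in atTop, ∀ (x : ℕ → ℝ) (S : Finset ℕ), IsSeedBSEstimate a m γ θ T x S →
      NoiseControlled T (f T) x (8 * Real.log T) →
      IsLocalized T (f T) S (1312 * (K + 1) ^ 2 * Real.log T) := by
  obtain ⟨ha₀, ha₁⟩ := ha
  filter_upwards [hf, eventually_gt_atTop 1,
    eventually_mul_log_rpow_lt (max 8 (4 * m)) ha₀ (zero_lt_one.trans (hθ.trans hθθ₀)),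
    eventually_mul_log_rpow_lt (48 * (K + 1) ^ 2 * 8) hγ hθ,
    eventually_mul_log_rpow_lt (24 * (K + 1) * γ) (show 0 < a * c ^ 2 by positivity) hθθ₀] with
    T ⟨hspacing, hcard, hjump⟩ hT hmin hpen hdpen x S hS hx
  rw [Real.rpow_zero, mul_one] at hmin
  rw [Real.rpow_one] at hpen
  have hlog : 0 < Real.log T := Real.log_pos (Nat.one_lt_cast.2 hT)
  have hmin' := hmin.le.trans (mul_le_mul_of_nonneg_left hspacing ha₀.le)
  have hsq : (((changePoints T (f T)).card : ℝ) + 1) ^ 2 ≤ (K + 1) ^ 2 := by gcongr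
  refine (hS.isLocalized ha₀ ha₁ hx (by positivity) (spaced_minSpacing T (f T))
    ((le_max_left _ _).trans hmin') ((le_max_right _ _).trans hmin') ?_ fun η hη => ?_).mono ?_
  · calc _ ≤ 48 * (K + 1) ^ 2 * (8 * Real.log T) := by gcongr
      _ ≤ γ * Real.log T ^ θ := by linarith
  · calc 24 * (((changePoints T (f T)).card : ℝ) + 1) * (γ * Real.log T ^ θ)
        ≤ 24 * (K + 1) * (γ * Real.log T ^ θ) := by gcongr
      _ < a * (c ^ 2 * Real.log T ^ θ₀) := by linarith
      _ ≤ a * (jump (f T) η ^ 2 * minSpacing T (changePoints T (f T))) := by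
          have := hjump η hη
          gcongr
  · calc _ ≤ 164 * (K + 1) ^ 2 * (8 * Real.log T) := by gcongr
      _ = 1312 * (K + 1) ^ 2 * Real.log T := by ring

end SeedBS

theorem theorem4_general (K : ℝ) :
    ∃ C : ℝ, ∀ (θ₀ θ γ c a : ℝ) (m : ℕ), 1 < θ → θ < θ₀ → 0 < γ → 0 < c →
      a ∈ Set.Ioo (0 : ℝ) 1 →
      ∀ f : ℕ → ℕ → ℝ,
        (∀ᶠ T : ℕ in atTop,
          Real.log T ^ θ₀ ≤ (SeedBS.minSpacing T (SeedBS.changePoints T (f T)) : ℝ) ∧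
          ((SeedBS.changePoints T (f T)).card : ℝ) ≤ K ∧
          ∀ η ∈ SeedBS.changePoints T (f T), c ≤ SeedBS.jump (f T) η) →
      ∀ (Ω : ℕ → Type*) [∀ T, MeasurableSpace (Ω T)] (P : ∀ T, Measure (Ω T))
        [∀ T, IsProbabilityMeasure (P T)] (X : ∀ T, ℕ → Ω T → ℝ),
        (∀ T, SeedBS.IsGaussianModel (P T) T (f T) (X T)) →
      ∀ S : ∀ T, Ω T → Finset ℕ,
        (∀ T ω, SeedBS.IsSeedBSEstimate a m γ θ T (fun t => X T t ω) (S T ω)) →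
        Tendsto
          (fun T : ℕ => P T {ω | SeedBS.IsLocalized T (f T) (S T ω) (C * Real.log T)})
          atTop (𝓝 1) := by
  refine ⟨1312 * (K + 1) ^ 2, fun θ₀ θ γ c a m hθ hθθ₀ hγ hc ha f hf Ω _ P _ X hX S hS => ?_⟩
  refine tendsto_of_tendsto_of_tendsto_of_le_of_le' (SeedBS.tendsto_measure_noiseControlled hX)
    tendsto_const_nhds ?_ (Eventually.of_forall fun T => prob_le_one)
  filter_upwards [SeedBS.eventually_isLocalized m hθ hθθ₀ hγ hc ha hf] with T hT
  exact measure_mono fun ω hω => hT _ _ (hS T ω) hω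

theorem theorem4 (θ₀ θ γ c₁ c₂ : ℝ) (hθ : 1 < θ) (hθθ₀ : θ < θ₀) (hγ : 0 < γ)
    (hc₁ : 0 < c₁) (hc : c₁ < c₂) :
    -- the constant depends neither on `T` and `a` nor on the minimal length `m` or the signals
    ∃ C : ℝ, ∀ (a : ℝ) (m : ℕ), a ∈ Set.Ico (1 / 2 : ℝ) 1 → 2 ≤ m →
      -- a signal `f T` for every sample size `T`
      ∀ f : ℕ → ℕ → ℝ,
        (∀ᶠ T : ℕ in atTop,
          Real.log T ^ θ₀ ≤ (SeedBS.minSpacing T (SeedBS.changePoints T (f T)) : ℝ) ∧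
          ((SeedBS.changePoints T (f T)).card : ℝ) ∈ Set.Ioo c₁ c₂ ∧
          ∀ η ∈ SeedBS.changePoints T (f T), SeedBS.jump (f T) η ∈ Set.Ioo c₁ c₂) →
      ∀ (Ω : ℕ → Type*) [∀ T, MeasurableSpace (Ω T)] (P : ∀ T, Measure (Ω T))
        [∀ T, IsProbabilityMeasure (P T)] (X : ∀ T, ℕ → Ω T → ℝ),
        (∀ T, SeedBS.IsGaussianModel (P T) T (f T) (X T)) →
      ∀ S : ∀ T, Ω T → Finset ℕ,
        (∀ T ω, SeedBS.IsSeedBSEstimate a m γ θ T (fun t => X T t ω) (S T ω)) →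
        Tendsto
          (fun T : ℕ => P T {ω |
            ∃ hN : (S T ω).card = (SeedBS.changePoints T (f T)).card,
              ∀ i : Fin (SeedBS.changePoints T (f T)).card,
                SeedBS.jump (f T) ((SeedBS.changePoints T (f T)).orderEmbOfFin rfl i) ^ 2 *
                    |((S T ω).orderEmbOfFin hN i : ℝ) -
                      ((SeedBS.changePoints T (f T)).orderEmbOfFin rfl i : ℝ)| ≤
                  C * Real.log T})
          atTop (𝓝 1) := by
  obtain ⟨C, hC⟩ := theorem4_general c₂
  exact ⟨C, fun a m ha _ f hf Ω _ P _ X => hC θ₀ θ γ c₁ a m hθ hθθ₀ hγ hc₁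
    ⟨by linarith [ha.1], ha.2⟩ f
    (hf.mono fun T h => ⟨h.1, h.2.1.2.le, fun η hη => (h.2.2 η hη).1.le⟩) Ω P X⟩
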